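/- **Model.** A two-sided market has $n$ server types (each with its own queue), $m$ customer types and a set $E\subseteq[n]\times[m]$ of compatible pairs. For each customer type $j$ the inverse demand curve $F_j$ on $[0,\infty)$ is strictly decreasing and twice continuously differentiable, and $x\mapsto xF_j(x)$ is concave. The inverse supply curves $G_i$ on $[0,\infty)$ are continuous. A type-$i$ server who joins queue $l$ has utility $u_{il}=f_{il}(\mathbf p,\boldsymbol\chi)$, where $\mathbf p\in\mathbb R_+^n$ is the vector of posted server prices, $\boldsymbol\chi\in\mathbb R_+^{n\times m}$ is the matrix of steady-state matching rates, and $f_{il}$ is continuous. Waiting penalties are $\mathbf s\ge 0$ per agent and unit of time. For $\boldsymbol\mu\in\mathbb R^n$ let $\mathcal M(\boldsymbol\mu,\boldsymbol\chi)$ be the set of $\mathbf p\in\mathbb R^n_+$ for which there are a row-stochastic matrix $\nu\ge0$ and $\hat{\boldsymbol\mu}\ge 0$ such that $\nu_{il}>0$ implies $u_{il}\ge u_{il'}$ for all $l'$, $G_i(\hat\mu_i)=\max_l u_{il}$ and $\mu_i=\sum_l\hat\mu_l\nu_{li}$ for all $i$. Put $\Omega(\boldsymbol\chi)=\{\boldsymbol\mu:\mathcal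 M(\boldsymbol\mu,\boldsymbol\chi)\ne\emptyset\}$ and $c(\boldsymbol\mu,\boldsymbol\chi)=\inf\{\langle\boldsymbol\mu,\mathbf p\rangle:\mathbf p\in\mathcal M(\boldsymbol\mu,\boldsymbol\chi)\}$. The *fluid problem* is to maximize $\sum_jF_j(\lambda_j)\lambda_j-\int c(\boldsymbol\mu,\boldsymbol\chi)\,d\alpha(\boldsymbol\mu)$ over $\boldsymbol\lambda\in\mathbb R^m$, $\boldsymbol\chi\in\mathbb R_+^{n\times m}$ with $\chi_{ij}=0$ for $(i,j)\notin E$, and probability measures $\alpha$ carried by $\Omega(\boldsymbol\chi)$ with finite mean rates and finite mean cost, subject to $\lambda_j=\sum_i\chi_{ij}$ and $\int\mu_i\,d\alpha=\sum_j\chi_{ij}$. Let $\tilde R^\star_e$ be its value and let $(\boldsymbol\lambda^\star,\alpha^\star,\boldsymbol\chi^\star)$ be an optimal solution. If the operator sets customer rates $\boldsymbol\lambda$ and the randomized server rates $\alpha$ in a slot, then the numbers of arrivals in that slot, of servers at the server queues and of customers of each type, have a joint law that depends only on $(\boldsymbol\lambda,\alpha)$. Assume that for some $A_{\max}$, all $\boldsymbol\lambda\ge0$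 in a neighbourhood of $\boldsymbol\lambda^\star$ and $\alpha=\alpha^\star$, every coordinate is at most $A_{\max}$ and the means are $\int\boldsymbol\mu\,d\alpha$ and $\boldsymbol\lambda$. **Policy $\pi_\eta$.** Let $\epsilon_\eta=\eta^{-1/3}$. For every pair $(i,j)$ with $\chi^\star_{ij}>0$ there is a secondary queue of type-$j$ customers, of length $q^{(2)}_{ij}$, and a secondary queue of servers from queue $i$, of length $q^{(1)}_{ij}$, and only these two are matched with each other; the state is the vector of all these lengths. In every state the operator uses $\alpha^\star$ for the servers and the customer rates $$\lambda_{j}(\mathbf q)=\lambda^\star_j-\epsilon_\eta\sum_{i:\chi^\star_{ij}>0}\mathbf 1\{q^{(2)}_{ij}>0\}+\epsilon_\eta\sum_{i:\chi^\star_{ij}>0}\mathbf 1\{q^{(2)}_{ij}=0\}.$$ Arriving agents are immediately and independently routed to secondary queues: a server of queue $i$ to $(i,j)$ with probability proportional to $\chi^\star_{ij}$, a customer of type $j$ to $(i,j)$ with probability proportional to $\chi^\star_{ij}+\epsilon_\eta$ if $q^{(2)}_{ij}=0$ and to $\chi^\star_{ij}-\epsilon_\eta$ if $q^{(2)}_{ij}>0$.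 Then as many pairs as possible are matched in each pair of secondary queues. The state space of the resulting Markov chain is the set of states reachable from the empty system. In the $\eta$-th system there are $\eta$ slots per unit of time. Let $y_{ij}$ be the number of matches of servers of queue $i$ with type-$j$ customers in a slot, let $\bar{\mathbf q}$ be the steady-state queue lengths (servers per queue and customers per type), and $$L_\eta(\pi_\eta)=\eta\tilde R^\star_e-\Big(\eta\,\mathbb E\Big[\sum_jF_j(\lambda_j(\bar{\mathbf q}))\lambda_j(\bar{\mathbf q})-\int c(\boldsymbol\mu,\mathbb E[\bar{\mathbf y}])\,d\alpha^\star(\boldsymbol\mu)\Big]-\mathbb E\langle\mathbf s,\bar{\mathbf q}\rangle\Big).$$ **Statement.** There is a constant $C$ such that for all sufficiently large $\eta$ the following holds. The policy $\pi_\eta$ is implementable: its rates are nonnegative, its matches are feasible, and the arrivals follow the law given by its rates. The chain has a stationary distribution; if it is irreducible on its state space, it is positive recurrent and its stationary distribution is unique. In every stationary distribution: 1. $\mathbb E[\bar y_{ij}]=\chi^\star_{ij}$ for all $i,j$; 2. the system is in equilibrium: in every state, the server rates drawn from $\alpha^\star$ lie almost surely in $\Omega(\mathbb E[\bar{\mathbf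 y}])$, that is, they arise from an equilibrium of the servers at suitable prices when utilities are evaluated at the actual steady-state matching rates; 3. the expected total queue length is finite, the expectations that define $L_\eta(\pi_\eta)$ exist, and $|L_\eta(\pi_\eta)|\le C\eta^{1/3}$. -/

import Mathlib

open MeasureTheory Filter Topology
open scoped ENNReal

noncomputable section

/-! ### Discrete time Markov chains on a set of states -/

namespace MarkovChain

variable {S : Type} (P : S → PMF S)

/-- `y` can be reached from `x` in finitely many (possibly zero) steps of positive probability. -/
def Accessible (x y : S) : Prop :=
  Relation.ReflTransGen (fun u v => v ∈ (P u).support) x y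

open Classical in
/-- `avoid P x k y` is the probability that the chain started at `y` is not at `x` at any of the
times `1, …, k`. -/
def avoid (x : S) : ℕ → S → ℝ≥0∞
  | 0, _ => 1
  | k + 1, y => ∑' z, P y z * (if z = x then 0 else avoid x k z)

/-- Finite mean return time: `E_x[T_x] = ∑_{k ≥ 0} P_x(T_x > k) < ∞`. -/
def PositiveRecurrent (x : S) : Prop := ∑' k, avoid P x k x ≠ ∞

/-- Positive probability of never returning. -/
def Transient (x : S) : Prop := 0 < ⨅ k, avoid P x k x

/-- Stability of the chain with distinguished state `o`, whose state space consists of the states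
that can be reached from `o`: the communicating class of `o` is positive recurrent, and all other
states of the state space (if any) are transient. -/
def Stable (o : S) : Prop :=
  (∀ x, Accessible P o x → Accessible P x o → PositiveRecurrent P x) ∧
  (∀ x, Accessible P o x → ¬ Accessible P x o → Transient P x)

/-- The chain is irreducible on the set of states that can be reached from `o`. -/
def IrreducibleFrom (o : S) : Prop := ∀ x, Accessible P o x → Accessible P x o

/-- `ψ` is a stationary distribution carried by the states that can be reached from `o`. -/
def IsStationary (o : S) (ψ : PMF S) : Prop :=
  ψ.bind P = ψ ∧ ∀ x ∈ ψ.support, Accessible P o x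

end MarkovChain

/-! ### The market -/

/-- The primitives of a two-sided matching market with `n` server types (and as many server
queues) and `m` customer types. Matching rates are matrices `χ : Fin n → Fin m → ℝ`. -/
structure Market (n m : ℕ) where
  /-- compatible (server, customer) pairs -/
  E : Set (Fin n × Fin m)
  /-- inverse demand curves on `[0, ∞)` -/
  F : Fin m → ℝ → ℝ
  F_strictAnti : ∀ j, StrictAntiOn (F j) (Set.Ici 0)
  F_contDiff : ∀ j, ContDiffOn ℝ 2 (F j) (Set.Ici 0)
  F_concave : ∀ j, ConcaveOn ℝ (Set.Ici 0) (fun x => x * F j x)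
  /-- inverse supply curves on `[0, ∞)` -/
  G : Fin n → ℝ → ℝ
  G_continuous : ∀ i, ContinuousOn (G i) (Set.Ici 0)
  /-- `f i l p χ` is the utility of a type `i` server who joins queue `l` when the posted server
  prices are `p` and the steady-state matching rates are `χ` -/
  f : Fin n → Fin n → (Fin n → ℝ) → (Fin n → Fin m → ℝ) → ℝ
  f_continuous : ∀ i l, ContinuousOn
    (fun x : (Fin n → ℝ) × (Fin n → Fin m → ℝ) => f i l x.1 x.2) (Set.Ici 0)
  /-- waiting penalties per unit of time of a server and of a customer -/
  s₁ : Fin n → ℝ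
  s₂ : Fin m → ℝ
  s₁_nonneg : ∀ i, 0 ≤ s₁ i
  s₂_nonneg : ∀ j, 0 ≤ s₂ j
  /-- joint law of the numbers of servers (by queue) and customers (by type) that arrive in one
  slot, given the customer rates and the randomized server pricing chosen by the operator -/
  arrival : (Fin m → ℝ) → Measure (Fin n → ℝ) → PMF ((Fin n → ℕ) × (Fin m → ℕ))

/-- A law of arrivals in one slot is bounded by `A` in every coordinate, and has the customer
rates `lam` and the `α`-average of the server rates as its means. -/
structure RealizesRates {n m : ℕ} (P : PMF ((Fin n → ℕ) × (Fin m → ℕ))) (A : ℕ)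
    (lam : Fin m → ℝ) (α : Measure (Fin n → ℝ)) : Prop where
  server_le : ∀ a ∈ P.support, ∀ i, a.1 i ≤ A
  customer_le : ∀ a ∈ P.support, ∀ j, a.2 j ≤ A
  server_mean : ∀ i, ∑' a, (P a).toReal * (a.1 i : ℝ) = ∫ μ, μ i ∂α
  customer_mean : ∀ j, ∑' a, (P a).toReal * (a.2 j : ℝ) = lam j

namespace Market

variable {n m : ℕ} (M : Market n m)

/-- Server prices `p` for which, at matching rates `χ`, there are joining strategies `ν` (rows are
probability vectors) and arrival rates `hatμ` of the server types that form an equilibrium and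
produce the rates `μ` in the server queues. -/
def consistentPrices (μ : Fin n → ℝ) (χ : Fin n → Fin m → ℝ) : Set (Fin n → ℝ) :=
  {p | (∀ l, 0 ≤ p l) ∧ ∃ (ν : Fin n → Fin n → ℝ) (hatμ : Fin n → ℝ),
    (∀ i l, 0 ≤ ν i l) ∧ (∀ i, ∑ l, ν i l = 1) ∧ (∀ i, 0 ≤ hatμ i) ∧
    (∀ i l, 0 < ν i l → ∀ l', M.f i l' p χ ≤ M.f i l p χ) ∧
    (∀ i, IsGreatest (Set.range fun l => M.f i l p χ) (M.G i (hatμ i))) ∧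
    (∀ i, μ i = ∑ l, hatμ l * ν l i)}

/-- Server rates that some prices support in equilibrium at matching rates `χ`. -/
def Omega (χ : Fin n → Fin m → ℝ) : Set (Fin n → ℝ) :=
  {μ | (M.consistentPrices μ χ).Nonempty}

/-- Least cost of inducing the server rates `μ` at matching rates `χ`. -/
def cost (μ : Fin n → ℝ) (χ : Fin n → Fin m → ℝ) : ℝ :=
  sInf ((fun p => ∑ i, μ i * p i) '' M.consistentPrices μ χ)

/-! ### The probabilistic fluid model -/

/-- Feasible triples of the fluid problem. Integrability says that the mean server rates and the
mean cost are finite. -/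
structure FluidFeasible (lam : Fin m → ℝ) (α : Measure (Fin n → ℝ)) (χ : Fin n → Fin m → ℝ) :
    Prop where
  prob : IsProbabilityMeasure α
  support : ∀ᵐ μ ∂α, μ ∈ M.Omega χ
  integrable_rate : ∀ i, Integrable (fun μ => μ i) α
  integrable_cost : Integrable (fun μ => M.cost μ χ) α
  customer_balance : ∀ j, lam j = ∑ i, χ i j
  server_balance : ∀ i, ∫ μ, μ i ∂α = ∑ j, χ i j
  compatible : ∀ i j, (i, j) ∉ M.E → χ i j = 0
  nonneg : ∀ i j, 0 ≤ χ i j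

/-- Profit per slot of a fluid triple. -/
def fluidProfit (lam : Fin m → ℝ) (α : Measure (Fin n → ℝ)) (χ : Fin n → Fin m → ℝ) : ℝ :=
  ∑ j, M.F j (lam j) * lam j - ∫ μ, M.cost μ χ ∂α

/-- The set of profits of all feasible triples. -/
def fluidProfits : Set ℝ :=
  {r | ∃ lam α χ, M.FluidFeasible lam α χ ∧ r = M.fluidProfit lam α χ}

/-- Optimal value of the fluid problem. -/
def fluidValue : ℝ := sSup M.fluidProfits

/-- An optimal solution of the fluid problem. -/
def IsFluidOptimal (lam : Fin m → ℝ) (α : Measure (Fin n → ℝ)) (χ : Fin n → Fin m → ℝ) : Prop :=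
  M.FluidFeasible lam α χ ∧
    ∀ lam' α' χ', M.FluidFeasible lam' α' χ' → M.fluidProfit lam' α' χ' ≤ M.fluidProfit lam α χ

end Market

/-! ### Stationary policies over an expanded state space -/

/-- What happens in one time slot: server arrivals, customer arrivals, matches, next state. -/
structure SlotOutcome (n m : ℕ) (S : Type) where
  a₁ : Fin n → ℕ
  a₂ : Fin m → ℕ
  y : Fin n → Fin m → ℕ
  next : S

/-- A stationary pricing and matching policy whose decisions depend on an expanded state that
determines the numbers of servers and customers waiting. `slot q` is the joint law of what
happens in a slot that starts in state `q`. -/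
structure Policy (n m : ℕ) where
  State : Type
  /-- the empty system -/
  empty : State
  /-- numbers of waiting servers and of waiting customers -/
  q₁ : State → Fin n → ℕ
  q₂ : State → Fin m → ℕ
  /-- customer rates and randomized server rates set by the operator -/
  lam : State → Fin m → ℝ
  α : State → Measure (Fin n → ℝ)
  slot : State → PMF (SlotOutcome n m State)

namespace Policy

variable {n m : ℕ} (π : Policy n m)

/-- Transition law of the state. -/
def step (q : π.State) : PMF π.State := (π.slot q).map SlotOutcome.next

/-- The state space: the states that can be reached from the empty system. -/
def stateSpace : Set π.State := {q | MarkovChain.Accessible π.step π.empty q}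

def IsStable : Prop := MarkovChain.Stable π.step π.empty

def IsIrreducible : Prop := MarkovChain.IrreducibleFrom π.step π.empty

/-- `ψ` is the law of the state in steady state. -/
def IsSteadyState (ψ : PMF π.State) : Prop := MarkovChain.IsStationary π.step π.empty ψ

/-- The policy obeys the rules of the market `M`: rates are nonnegative, the arrivals follow the
law given by the rates, the matches are feasible, and the queues evolve by
`q(k+1) = q(k) + a(k) - x(k)`. -/
structure IsImplementable (M : Market n m) : Prop where
  empty₁ : ∀ i, π.q₁ π.empty i = 0
  empty₂ : ∀ j, π.q₂ π.empty j = 0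
  lam_nonneg : ∀ q ∈ π.stateSpace, ∀ j, 0 ≤ π.lam q j
  prob : ∀ q ∈ π.stateSpace, IsProbabilityMeasure (π.α q)
  arrivals : ∀ q ∈ π.stateSpace,
    (π.slot q).map (fun o => (o.a₁, o.a₂)) = M.arrival (π.lam q) (π.α q)
  match_server : ∀ q ∈ π.stateSpace, ∀ o ∈ (π.slot q).support, ∀ i,
    ∑ j, o.y i j ≤ π.q₁ q i + o.a₁ i
  match_customer : ∀ q ∈ π.stateSpace, ∀ o ∈ (π.slot q).support, ∀ j,
    ∑ i, o.y i j ≤ π.q₂ q j + o.a₂ j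
  match_compatible : ∀ q ∈ π.stateSpace, ∀ o ∈ (π.slot q).support, ∀ i j,
    (i, j) ∉ M.E → o.y i j = 0
  evolve_server : ∀ q ∈ π.stateSpace, ∀ o ∈ (π.slot q).support, ∀ i,
    π.q₁ o.next i + ∑ j, o.y i j = π.q₁ q i + o.a₁ i
  evolve_customer : ∀ q ∈ π.stateSpace, ∀ o ∈ (π.slot q).support, ∀ j,
    π.q₂ o.next j + ∑ i, o.y i j = π.q₂ q j + o.a₂ j

/-- Steady-state expected number of matches of type `i` servers with type `j` customers in a
slot. -/
def matchRate (ψ : PMF π.State) (i : Fin n) (j : Fin m) : ℝ≥0∞ :=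
  ∑' q, ψ q * ∑' o, π.slot q o * (o.y i j : ℝ≥0∞)

/-- Steady-state matching rates as a real matrix. -/
def rates (ψ : PMF π.State) : Fin n → Fin m → ℝ := fun i j => (π.matchRate ψ i j).toReal

/-- The system is in equilibrium: the steady-state matching rates are finite, and in every state
the server rates set by the operator are almost surely supported in equilibrium by some prices,
where the utilities of the servers are evaluated at the actual steady-state matching rates. -/
def InEquilibrium (M : Market n m) (ψ : PMF π.State) : Prop :=
  (∀ i j, π.matchRate ψ i j ≠ ∞) ∧
    ∀ q ∈ π.stateSpace, ∀ᵐ μ ∂(π.α q), μ ∈ M.Omega (π.rates ψ)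

/-- Steady-state expected total number of waiting agents. -/
def meanQueue (ψ : PMF π.State) : ℝ≥0∞ :=
  ∑' q, ψ q * (((∑ i, π.q₁ q i + ∑ j, π.q₂ q j : ℕ)) : ℝ≥0∞)

/-- Expected profit of a slot that starts in state `q`. -/
def slotProfit (M : Market n m) (ψ : PMF π.State) (q : π.State) : ℝ :=
  ∑ j, M.F j (π.lam q j) * π.lam q j - ∫ μ, M.cost μ (π.rates ψ) ∂(π.α q)

/-- Waiting penalty per unit of time in state `q`. -/
def penalty (M : Market n m) (q : π.State) : ℝ :=
  ∑ i, M.s₁ i * π.q₁ q i + ∑ j, M.s₂ j * π.q₂ q j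

/-- The expectations that define the net profit exist and are finite. -/
structure HasNetProfit (M : Market n m) (ψ : PMF π.State) : Prop where
  cost : ∀ q ∈ π.stateSpace, Integrable (fun μ => M.cost μ (π.rates ψ)) (π.α q)
  profit : Summable fun q => (ψ q).toReal * π.slotProfit M ψ q
  penalty : Summable fun q => (ψ q).toReal * π.penalty M q

/-- Long run average net profit per unit of time in the `η`-th system, in which there are `η` slots
per unit of time. -/
def netProfit (M : Market n m) (η : ℝ) (ψ : PMF π.State) : ℝ :=
  η * (∑' q, (ψ q).toReal * π.slotProfit M ψ q) - ∑' q, (ψ q).toReal * π.penalty M q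

/-- Net profit loss in the `η`-th system, relative to `η` times the fluid value. -/
def netProfitLoss (M : Market n m) (η : ℝ) (ψ : PMF π.State) : ℝ :=
  η * M.fluidValue - π.netProfit M η ψ

end Policy

/-! ### Multiple-price policy with random matching -/

namespace RandomMatching

theorem sum_ofReal_ne_top {κ : Type} [Fintype κ] (w : κ → ℝ) :
    ∑' k, ENNReal.ofReal (w k) ≠ ∞ := by
  rw [tsum_fintype]
  exact ENNReal.sum_ne_top.2 fun _ _ => ENNReal.ofReal_ne_top

open Classical in
/-- Law of the numbers of agents sent to each `k : κ` when `N` agents are routed independently of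
one another with probabilities proportional to the weights `w`. (If no weight is positive, nobody
is routed.) -/
def splitLaw {κ : Type} [Fintype κ] (w : κ → ℝ) : ℕ → PMF (κ → ℕ)
  | 0 => PMF.pure 0
  | N + 1 =>
    if h : ∑' k, ENNReal.ofReal (w k) ≠ 0 then
      (PMF.normalize (fun k => ENNReal.ofReal (w k)) h (sum_ofReal_ne_top w)).bind fun k =>
        (splitLaw w N).map fun b => b + Pi.single k 1
    else PMF.pure 0

/-- The law of independent vectors with the laws `P t`. -/
def indepLaw {τ κ : Type} [Fintype τ] [Fintype κ] (P : τ → PMF (κ → ℕ)) : PMF (τ → κ → ℕ) :=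
  (Measure.pi fun t => (P t).toMeasure).toPMF

/-- Secondary queue lengths: `q.1 i j` servers of queue `i` are waiting for customers of type `j`
and `q.2 i j` customers of type `j` are waiting for servers of queue `i`. Only the pairs `(i, j)`
with a positive fluid matching rate are ever used. -/
abbrev SecState (n m : ℕ) : Type := (Fin n → Fin m → ℕ) × (Fin n → Fin m → ℕ)

variable {n m : ℕ}

open Classical in
/-- Two-price rate of the customers of type `j` who are sent to their secondary queue `(i, j)`. -/
def secRate (χ : Fin n → Fin m → ℝ) (ε : ℝ) (q : SecState n m) (i : Fin n) (j : Fin m) : ℝ :=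
  if 0 < χ i j then χ i j + (if q.2 i j = 0 then ε else -ε) else 0

open Classical in
/-- Multiple-price rate of the customers of type `j`. -/
def customerRate (lam : Fin m → ℝ) (χ : Fin n → Fin m → ℝ) (ε : ℝ) (q : SecState n m)
    (j : Fin m) : ℝ :=
  lam j - ε * (∑ i, if 0 < χ i j ∧ 0 < q.2 i j then 1 else 0)
    + ε * (∑ i, if 0 < χ i j ∧ q.2 i j = 0 then 1 else 0)

open Classical in
/-- Matches in the secondary queues, given the secondary arrivals `b`: as many as possible. -/
def secMatch (χ : Fin n → Fin m → ℝ) (q b : SecState n m) (i : Fin n) (j : Fin m) : ℕ :=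
  if 0 < χ i j then min (q.1 i j + b.1 i j) (q.2 i j + b.2 i j) else 0

/-- The secondary arrivals, given the arrivals `a`: every agent is routed at random as soon as it
arrives, servers proportionally to the fluid matching rates and customers proportionally to the
two-price rates of the secondary queues. -/
def routeLaw (χ : Fin n → Fin m → ℝ) (ε : ℝ) (q : SecState n m)
    (a : (Fin n → ℕ) × (Fin m → ℕ)) : PMF (SecState n m) :=
  (indepLaw fun i => splitLaw (fun j => χ i j) (a.1 i)).bind fun b₁ =>
    (indepLaw fun j => splitLaw (fun i => secRate χ ε q i j) (a.2 j)).map fun b₂ =>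
      (b₁, fun i j => b₂ j i)

/-- The multiple-price policy with perturbation `ε` around the fluid solution `(lam, α, χ)`,
combined with random matching. -/
def policy (M : Market n m) (lam : Fin m → ℝ) (α : Measure (Fin n → ℝ)) (χ : Fin n → Fin m → ℝ)
    (ε : ℝ) : Policy n m where
  State := SecState n m
  empty := (0, 0)
  q₁ := fun q i => ∑ j, q.1 i j
  q₂ := fun q j => ∑ i, q.2 i j
  lam := customerRate lam χ ε
  α := fun _ => α
  slot := fun q => (M.arrival (customerRate lam χ ε q) α).bind fun a =>
    (routeLaw χ ε q a).map fun b =>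
      { a₁ := a.1
        a₂ := a.2
        y := secMatch χ q b
        next := (fun i j => q.1 i j + b.1 i j - secMatch χ q b i j,
          fun i j => q.2 i j + b.2 i j - secMatch χ q b i j) }

end RandomMatching

end

/-! Write ε for η^(-1/3). Every pair (i, j) with χ⋆ > 0 runs its own two secondary queues, and
matching leaves at most one of them nonempty. Servers reach the pair at mean rate χ⋆ in every state;
customers do so at χ⋆ - ε while customers wait and at χ⋆ + ε otherwise. The waiting side therefore
shrinks at mean rate ε, and the sum of squared lengths has drift at most -2ε·(total length) + nmA²
(`Admissible.drift`). Foster's criterion (`Drift.exists_stationary`) gives a stationary law, and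
`Drift.expect_le` bounds its mean total length by nmA²/(2ε).

Finite mean lengths permit flow balance. On the server side it shows that the matching rates are
exactly χ⋆ (`matchRate_eq`), so supportability and cost at the actual rates coincide with those of
the fluid solution. On the customer side it shows that the two-price rates average to χ⋆
(`expect_secRate`), so customer rates average to λ⋆ and the linear term in the Taylor expansion of
the revenue has mean zero. What remains is O(ε²) per slot. The loss is thus at most a constant times
ηε² + 1/ε, and ε = η^(-1/3) makes both terms of order η^(1/3).

Under irreducibility, positive recurrence comes from Kac's identity, and uniqueness from the
invariance of the pointwise minimum of two stationary laws (`stationary_sub_inf`). -/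

noncomputable section

/-! ### Expectations of nonnegative functions -/

/-- Expectation of a nonnegative function under a probability mass function. -/
def expect {S : Type*} (p : PMF S) (f : S → ℝ≥0∞) : ℝ≥0∞ := ∑' x, p x * f x

section Expect

variable {S T : Type*}

theorem expect_pure (x : S) (f : S → ℝ≥0∞) : expect (PMF.pure x) f = f x := by
  classical
  unfold expect
  rw [tsum_eq_single x]
  · simp
  · intro y hy
    simp [PMF.pure_apply, hy]

theorem expect_bind (p : PMF S) (k : S → PMF T) (f : T → ℝ≥0∞) :
    expect (p.bind k) f = expect p fun x => expect (k x) f := by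
  unfold expect
  simp only [PMF.bind_apply, ← ENNReal.tsum_mul_right, ← ENNReal.tsum_mul_left]
  rw [ENNReal.tsum_comm]
  simp only [mul_assoc]

theorem expect_map (p : PMF S) (g : S → T) (f : T → ℝ≥0∞) :
    expect (p.map g) f = expect p fun x => f (g x) := by
  rw [← PMF.bind_pure_comp, expect_bind]
  simp only [Function.comp, expect_pure]

theorem expect_add (p : PMF S) (f g : S → ℝ≥0∞) :
    (expect p fun x => f x + g x) = expect p f + expect p g := by
  unfold expect
  simp only [mul_add, ENNReal.tsum_add]

theorem expect_mul_left (p : PMF S) (c : ℝ≥0∞) (f : S → ℝ≥0∞) :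
    (expect p fun x => c * f x) = c * expect p f := by
  unfold expect
  rw [← ENNReal.tsum_mul_left]
  simp only [mul_left_comm]

theorem expect_mul_right (p : PMF S) (c : ℝ≥0∞) (f : S → ℝ≥0∞) :
    (expect p fun x => f x * c) = expect p f * c := by
  simp only [mul_comm _ c, expect_mul_left]

theorem expect_const (p : PMF S) (c : ℝ≥0∞) : (expect p fun _ => c) = c := by
  unfold expect
  rw [ENNReal.tsum_mul_right, p.tsum_coe, one_mul]

theorem expect_mono {p : PMF S} {f g : S → ℝ≥0∞} (h : ∀ x ∈ p.support, f x ≤ g x) :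
    expect p f ≤ expect p g := by
  refine ENNReal.tsum_le_tsum fun x => ?_
  by_cases hx : p x = 0
  · simp [hx]
  · exact mul_le_mul_right (h x hx) _

theorem expect_congr {p : PMF S} {f g : S → ℝ≥0∞} (h : ∀ x ∈ p.support, f x = g x) :
    expect p f = expect p g :=
  le_antisymm (expect_mono fun x hx => (h x hx).le) (expect_mono fun x hx => (h x hx).ge)

theorem expect_finset_sum {ι : Type*} (p : PMF S) (s : Finset ι) (f : ι → S → ℝ≥0∞) :
    (expect p fun x => ∑ i ∈ s, f i x) = ∑ i ∈ s, expect p (f i) := by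
  unfold expect
  simp only [Finset.mul_sum]
  exact Summable.tsum_finsetSum fun _ _ => ENNReal.summable

/-- The real expectation of a nonnegative real function with finite expectation. -/
theorem tsum_toReal_mul_eq (p : PMF S) {f : S → ℝ} (hf : ∀ x ∈ p.support, 0 ≤ f x) :
    ∑' x, (p x).toReal * f x = (expect p fun x => ENNReal.ofReal (f x)).toReal := by
  unfold expect
  rw [ENNReal.tsum_toReal_eq]
  · refine tsum_congr fun x => ?_
    by_cases hx : p x = 0
    · simp [hx]
    · rw [ENNReal.toReal_mul, ENNReal.toReal_ofReal (hf x hx)]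
  · exact fun x => ENNReal.mul_ne_top (p.apply_ne_top x) ENNReal.ofReal_ne_top

theorem summable_toReal_mul (p : PMF S) {f : S → ℝ} (hf : ∀ x ∈ p.support, 0 ≤ f x)
    (h : (expect p fun x => ENNReal.ofReal (f x)) ≠ ∞) :
    Summable fun x => (p x).toReal * f x := by
  have := ENNReal.summable_toReal h
  refine this.congr fun x => ?_
  by_cases hx : p x = 0
  · simp [hx]
  · rw [ENNReal.toReal_mul, ENNReal.toReal_ofReal (hf x hx)]

/-- Upgrades one-sided invariance to invariance: a domination without loss of finite total mass is
an equality. -/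
theorem eq_of_le_of_tsum_le {f g : S → ℝ≥0∞} (h : ∀ x, f x ≤ g x)
    (hf : ∑' x, f x ≠ ∞) (hs : ∑' x, g x ≤ ∑' x, f x) : f = g := by
  funext x
  by_contra hx
  exact absurd (ENNReal.tsum_lt_tsum hf h (lt_of_le_of_ne (h x) hx)) (not_lt.2 hs)

end Expect

/-! ### Stationary distributions of Markov chains -/

namespace MarkovChain

variable {S : Type} {P : S → PMF S}

theorem expect_step_of_bind_eq {ψ : PMF S} (h : ψ.bind P = ψ) (f : S → ℝ≥0∞) :
    (expect ψ fun x => expect (P x) f) = expect ψ f := by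
  rw [← expect_bind, h]

/-- A stationary measure charges every state that can be reached from a state it charges. -/
theorem ne_zero_of_accessible {ν : S → ℝ≥0∞} (hν : ∀ x, ∑' y, ν y * P y x = ν x) {x y : S}
    (hxy : Accessible P x y) (hx : ν x ≠ 0) : ν y ≠ 0 := by
  induction hxy with
  | refl => exact hx
  | @tail u v _ huv ih =>
    rw [← hν v]
    intro h0
    rw [ENNReal.tsum_eq_zero] at h0
    exact mul_ne_zero ih ((PMF.mem_support_iff _ _).1 huv) (h0 u)

theorem apply_ne_zero_of_irreducible {o : S} (hirr : IrreducibleFrom P o) {ν : S → ℝ≥0∞}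
    (hν : ∀ x, ∑' y, ν y * P y x = ν x) (hacc : ∀ x, ν x ≠ 0 → Accessible P o x)
    {z : S} (hz : ν z ≠ 0) {x : S} (hx : Accessible P o x) : ν x ≠ 0 :=
  ne_zero_of_accessible hν ((hirr z (hacc z hz)).trans hx) hz

open Classical in
/-- One step of Kac's identity for the return time to `x`. -/
theorem apply_mul_avoid_add {ψ : PMF S} (h : ψ.bind P = ψ) (x : S) (k : ℕ) :
    ψ x * avoid P x k x + expect ψ (avoid P x (k + 1)) = expect ψ (avoid P x k) := by
  have h1 : expect ψ (avoid P x (k + 1)) =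
      expect ψ fun z => if z = x then 0 else avoid P x k z :=
    expect_step_of_bind_eq h fun z => if z = x then 0 else avoid P x k z
  have h2 : ψ x * avoid P x k x = expect ψ fun z => if z = x then avoid P x k z else 0 := by
    unfold expect
    rw [tsum_eq_single x]
    · simp
    · intro y hy
      simp [hy]
  rw [h1, h2, ← expect_add]
  congr 1
  funext z
  split_ifs <;> simp

/-- Kac's inequality: states charged by a stationary distribution are positive recurrent. -/
theorem positiveRecurrent_of_stationary {ψ : PMF S} (h : ψ.bind P = ψ) {x : S} (hx : ψ x ≠ 0) :
    PositiveRecurrent P x := by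
  -- The one-step identities telescope. Dropping the remainder `expect ψ (avoid P x K)` bounds ψ(x)
  -- times the mean return time by 1.
  have key : ∀ K, ψ x * ∑ k ∈ Finset.range K, avoid P x k x + expect ψ (avoid P x K) = 1 := by
    intro K
    induction K with
    | zero =>
      simp only [Finset.range_zero, Finset.sum_empty, mul_zero, zero_add]
      exact expect_const ψ 1
    | succ K ih =>
      rw [Finset.sum_range_succ, mul_add, add_assoc, apply_mul_avoid_add h, ih]
  have hle : ψ x * ∑' k, avoid P x k x ≤ 1 := by
    rw [ENNReal.tsum_eq_iSup_nat, ENNReal.mul_iSup]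
    exact iSup_le fun K => (key K) ▸ le_self_add
  intro htop
  rw [htop, ENNReal.mul_top hx] at hle
  exact absurd hle (by simp)

/-- The image of min(ψ, φ) under the chain lies below both ψ and φ and has the same finite mass as
the minimum, so the minimum is invariant. Hence the excess of ψ over it is invariant too. -/
theorem stationary_sub_inf {ψ φ : PMF S} (hψ : ψ.bind P = ψ) (hφ : φ.bind P = φ) (x : S) :
    ∑' y, (ψ y - min (ψ y) (φ y)) * P y x = ψ x - min (ψ x) (φ x) := by
  have e1 : ∀ x, ∑' y, ψ y * P y x = ψ x := fun x => by rw [← PMF.bind_apply, hψ]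
  have e2 : ∀ x, ∑' y, φ y * P y x = φ x := fun x => by rw [← PMF.bind_apply, hφ]
  have hsum : ∑' x, ∑' y, min (ψ y) (φ y) * P y x = ∑' y, min (ψ y) (φ y) := by
    rw [ENNReal.tsum_comm]
    refine tsum_congr fun y => ?_
    rw [ENNReal.tsum_mul_left, (P y).tsum_coe, mul_one]
  have hfin : ∑' y, min (ψ y) (φ y) ≠ ∞ :=
    ne_top_of_le_ne_top ψ.tsum_coe_ne_top (ENNReal.tsum_le_tsum fun y => min_le_left _ _)
  have hmin : (fun x => ∑' y, min (ψ y) (φ y) * P y x) = fun x => min (ψ x) (φ x) := by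
    refine eq_of_le_of_tsum_le (fun x => le_min ?_ ?_) (hsum ▸ hfin) hsum.ge
    · rw [← e1 x]
      exact ENNReal.tsum_le_tsum fun y => mul_le_mul_left (min_le_left _ _) _
    · rw [← e2 x]
      exact ENNReal.tsum_le_tsum fun y => mul_le_mul_left (min_le_right _ _) _
  have hx := congrFun hmin x
  have hxfin : min (ψ x) (φ x) ≠ ∞ := ne_top_of_le_ne_top (ψ.apply_ne_top x) (min_le_left _ _)
  refine ENNReal.eq_sub_of_add_eq hxfin ?_
  rw [← hx, ← ENNReal.tsum_add, ← e1 x]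
  refine tsum_congr fun y => ?_
  rw [← add_mul, tsub_add_cancel_of_le (min_le_left _ _)]

/-- An irreducible chain has at most one stationary distribution. -/
theorem IsStationary.unique {o : S} (hirr : IrreducibleFrom P o) {ψ φ : PMF S}
    (hψ : IsStationary P o ψ) (hφ : IsStationary P o φ) : ψ = φ := by
  have aux : ∀ ψ φ : PMF S, (∀ x, ψ x - min (ψ x) (φ x) = 0) → ψ = φ := by
    intro ψ φ h
    refine PMF.ext fun x => ?_
    refine congrFun (eq_of_le_of_tsum_le (fun x => ?_) ψ.tsum_coe_ne_top
      (by rw [ψ.tsum_coe, φ.tsum_coe])) x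
    exact (tsub_eq_zero_iff_le.1 (h x)).trans (min_le_right _ _)
  by_cases h1 : ∀ x, ψ x - min (ψ x) (φ x) = 0
  · exact aux ψ φ h1
  by_cases h2 : ∀ x, φ x - min (φ x) (ψ x) = 0
  · exact (aux φ ψ h2).symm
  -- If neither excess vanished identically, irreducibility would make both positive at `o`, where
  -- the smaller of the two laws has excess zero.
  push Not at h1 h2
  obtain ⟨y, hy⟩ := h1
  obtain ⟨z, hz⟩ := h2
  have hy' := apply_ne_zero_of_irreducible hirr (stationary_sub_inf hψ.1 hφ.1)
    (fun x hx => hψ.2 x fun h0 => hx (by simp [h0])) hy Relation.ReflTransGen.refl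
  have hz' := apply_ne_zero_of_irreducible hirr (stationary_sub_inf hφ.1 hψ.1)
    (fun x hx => hφ.2 x fun h0 => hx (by simp [h0])) hz Relation.ReflTransGen.refl
  rcases le_total (ψ o) (φ o) with h | h
  · exact absurd (by simp [h]) hy'
  · exact absurd (by simp [h]) hz'

/-- Irreducibility makes the transience clause of `Stable` vacuous and lets a stationary law charge
every reachable state, so that Kac's inequality applies everywhere. -/
theorem stable_of_stationary {o : S} (hirr : IrreducibleFrom P o) {ψ : PMF S}
    (hψ : IsStationary P o ψ) : Stable P o := by
  refine ⟨fun x hx _ => ?_, fun x hx hnot => absurd (hirr x hx) hnot⟩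
  obtain ⟨z, hz⟩ := ψ.support_nonempty
  exact positiveRecurrent_of_stationary hψ.1 (apply_ne_zero_of_irreducible hirr
    (fun x => by rw [← PMF.bind_apply, hψ.1]) (fun x hx => hψ.2 x hx) hz hx)

/-! ### Foster–Lyapunov drift -/

/-- The drift inequality `E_x[V(X₁)] ≤ V(x) - g(x) + B` on the states reachable from `o`. -/
def Drift (P : S → PMF S) (o : S) (V g : S → ℝ≥0∞) (B : ℝ≥0∞) : Prop :=
  ∀ x, Accessible P o x → expect (P x) V + g x ≤ V x + B

open Classical in
/-- Under the drift inequality every stationary distribution has `E[g] ≤ B`. -/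
theorem Drift.expect_le {o : S} {V g : S → ℝ≥0∞} {B : ℝ≥0∞} (hd : Drift P o V g B)
    (hV : ∀ x, V x ≠ ∞) {ψ : PMF S} (hψ : IsStationary P o ψ) : expect ψ g ≤ B := by
  -- `V` may have infinite mean under ψ, so the drift is integrated for min(V, K), whose mean is
  -- finite and cancels. Where V ≥ K the truncated function cannot increase in mean, and `g` is
  -- discarded there.
  have trunc : ∀ K : ℕ, (expect ψ fun x => if V x < K then g x else 0) ≤ B := by
    intro K
    have hfin : (expect ψ fun x => min (V x) K) ≠ ∞ := by
      refine ne_top_of_le_ne_top (ENNReal.natCast_ne_top K) ?_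
      refine (expect_mono fun x _ => min_le_right _ _).trans_eq (expect_const ψ _)
    have h1 : (expect ψ fun x => min (V x) K) + (expect ψ fun x => if V x < K then g x else 0)
        ≤ (expect ψ fun x => min (V x) K) + B := by
      rw [← expect_step_of_bind_eq hψ.1 fun x => min (V x) K]
      rw [← expect_add]
      conv_rhs => rw [expect_step_of_bind_eq hψ.1 fun x => min (V x) K, ← expect_const ψ B,
        ← expect_add]
      refine expect_mono fun x hx => ?_
      by_cases hK : V x < K
      · rw [if_pos hK, min_eq_left hK.le]
        exact (add_le_add_left (expect_mono fun y _ => min_le_left _ _) _).trans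
          (hd x (hψ.2 x hx))
      · rw [if_neg hK, min_eq_right (not_lt.1 hK), add_zero]
        refine le_trans ?_ le_self_add
        exact (expect_mono fun y _ => min_le_right _ _).trans_eq (expect_const _ _)
    exact (ENNReal.add_le_add_iff_left hfin).1 h1
  refine ENNReal.summable.tsum_le_of_sum_le fun F => ?_
  have hK : ∃ K : ℕ, ∀ x ∈ F, V x < K := by
    choose k hk using fun x => ENNReal.exists_nat_gt (hV x)
    refine ⟨F.sup k, fun x hx => (hk x).trans_le ?_⟩
    exact_mod_cast Finset.le_sup hx
  obtain ⟨K, hK⟩ := hK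
  refine le_trans ?_ (trunc K)
  refine le_trans (Finset.sum_le_sum fun x hx => ?_) (ENNReal.sum_le_tsum F)
  exact (congrArg (ψ x * ·) (if_pos (hK x hx)).symm).le

/-- Law of the chain started at `o` after `k` steps. -/
def law (P : S → PMF S) (o : S) : ℕ → PMF S
  | 0 => PMF.pure o
  | k + 1 => (law P o k).bind P

theorem accessible_of_law_ne_zero {o : S} {k : ℕ} {x : S} (h : law P o k x ≠ 0) :
    Accessible P o x := by
  induction k generalizing x with
  | zero =>
    have : x ∈ (PMF.pure o).support := h
    rw [PMF.support_pure, Set.mem_singleton_iff] at this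
    exact this ▸ Relation.ReflTransGen.refl
  | succ k ih =>
    have : x ∈ ((law P o k).bind P).support := h
    rw [PMF.mem_support_bind_iff] at this
    obtain ⟨y, hy, hyx⟩ := this
    exact (ih hy).tail hyx

/-- Telescoping of the drift inequality along the chain; with V(o) = 0 it keeps every Cesàro average
of `g` below `B`. -/
theorem Drift.sum_expect_law_le {o : S} {V g : S → ℝ≥0∞} {B : ℝ≥0∞} (hd : Drift P o V g B)
    (N : ℕ) :
    expect (law P o N) V + ∑ k ∈ Finset.range N, expect (law P o k) g ≤ V o + N * B := by
  induction N with
  | zero => simp [law, expect_pure]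
  | succ N ih =>
    have h1 : expect (law P o (N + 1)) V + expect (law P o N) g ≤ expect (law P o N) V + B := by
      rw [law, expect_bind, ← expect_add]
      conv_rhs => rw [← expect_const (law P o N) B, ← expect_add]
      exact expect_mono fun x hx => hd x (accessible_of_law_ne_zero hx)
    calc _ = (expect (law P o (N + 1)) V + expect (law P o N) g)
          + ∑ k ∈ Finset.range N, expect (law P o k) g := by
            rw [Finset.sum_range_succ]; ring
      _ ≤ (expect (law P o N) V + B) + ∑ k ∈ Finset.range N, expect (law P o k) g := by gcongr
      _ = (expect (law P o N) V + ∑ k ∈ Finset.range N, expect (law P o k) g) + B := by ring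
      _ ≤ (V o + N * B) + B := by gcongr
      _ = V o + (N + 1 : ℕ) * B := by push_cast; ring

/-- Average of the laws of the chain at the times `0, …, N`. -/
def cesaro (P : S → PMF S) (o : S) (N : ℕ) (x : S) : ℝ≥0∞ :=
  (N + 1 : ℝ≥0∞)⁻¹ * ∑ k ∈ Finset.range (N + 1), law P o k x

theorem natCast_add_one_mul_inv (N : ℕ) : (N + 1 : ℝ≥0∞)⁻¹ * (N + 1 : ℝ≥0∞) = 1 :=
  ENNReal.inv_mul_cancel (by simp) (by finiteness)

theorem tsum_cesaro_mul (o : S) (N : ℕ) (f : S → ℝ≥0∞) :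
    ∑' x, cesaro P o N x * f x =
      (N + 1 : ℝ≥0∞)⁻¹ * ∑ k ∈ Finset.range (N + 1), expect (law P o k) f := by
  unfold cesaro expect
  simp only [mul_assoc, Finset.sum_mul]
  rw [ENNReal.tsum_mul_left, Summable.tsum_finsetSum fun _ _ => ENNReal.summable]

theorem tsum_cesaro (o : S) (N : ℕ) : ∑' x, cesaro P o N x = 1 := by
  have h := tsum_cesaro_mul (P := P) o N fun _ => 1
  simp only [mul_one, expect_const, Finset.sum_const, Finset.card_range, nsmul_eq_mul] at h
  rw [h]
  exact_mod_cast natCast_add_one_mul_inv N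

/-- One step shifts the averaging window by one: every law in the new window but the last was
already in the old one, and the last is at most 1 at each state. -/
theorem cesaro_step_le (o : S) (N : ℕ) (x : S) :
    ∑' y, cesaro P o N y * P y x ≤ cesaro P o N x + (N + 1 : ℝ≥0∞)⁻¹ := by
  rw [tsum_cesaro_mul o N fun y => P y x, cesaro]
  conv_rhs => rw [← mul_one (N + 1 : ℝ≥0∞)⁻¹]
  rw [mul_assoc, one_mul, ← mul_add]
  refine mul_le_mul_right ?_ _
  have : ∀ k, expect (law P o k) (fun y => P y x) = law P o (k + 1) x := fun k => by
    rw [law, PMF.bind_apply]; rfl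
  simp only [this]
  rw [Finset.sum_range_succ]
  gcongr
  · rw [Finset.sum_range_succ' (fun k => law P o k x)]
    exact le_self_add
  · exact PMF.coe_le_one _ _

/-- Foster's criterion: a chain with a drift inequality whose drift `g` has finite sublevel sets
has a stationary distribution. -/
theorem Drift.exists_stationary {o : S} {V g : S → ℝ≥0∞} {B : ℝ≥0∞} (hd : Drift P o V g B)
    (hVo : V o = 0) (hB : B ≠ ∞)
    (hfin : ∀ K : ℕ, {x | Accessible P o x ∧ g x ≤ K}.Finite) : ∃ ψ, IsStationary P o ψ := by
  classical
  -- Since [0, ∞] is compact, a free ultrafilter yields limits of the Cesàro averages at all states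
  -- at once, without a diagonal extraction.
  let U : Ultrafilter ℕ := hyperfilter ℕ
  have hU : (U : Filter ℕ) ≤ atTop := by
    rw [← Nat.cofinite_eq_atTop]; exact hyperfilter_le_cofinite
  have hlim : ∀ x, ∃ L, Tendsto (fun N => cesaro P o N x) U (𝓝 L) := by
    intro x
    obtain ⟨L, -, hL⟩ := isCompact_univ.ultrafilter_le_nhds (U.map fun N => cesaro P o N x)
      (by simp)
    exact ⟨L, hL⟩
  choose ψ hψ using hlim
  have hinv : Tendsto (fun N : ℕ => (N + 1 : ℝ≥0∞)⁻¹) U (𝓝 0) := by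
    have := (ENNReal.tendsto_inv_nat_nhds_zero.comp (tendsto_add_atTop_nat 1)).mono_left hU
    refine this.congr fun N => ?_
    simp
  have hle1 : ∑' x, ψ x ≤ 1 := by
    refine ENNReal.summable.tsum_le_of_sum_le fun F => ?_
    refine le_of_tendsto (tendsto_finsetSum F fun x _ => hψ x) (Eventually.of_forall fun N => ?_)
    exact (ENNReal.sum_le_tsum F).trans_eq (tsum_cesaro o N)
  have hacc : ∀ x, ψ x ≠ 0 → Accessible P o x := by
    intro x hx
    by_contra hn
    have h0 : ∀ N, cesaro P o N x = 0 := fun N => by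
      rw [cesaro, Finset.sum_eq_zero, mul_zero]
      intro k _
      by_contra hk
      exact hn (accessible_of_law_ne_zero hk)
    exact hx (tendsto_nhds_unique (hψ x) (by simp only [h0]; exact tendsto_const_nhds))
  have hmean : ∀ N, ∑' x, cesaro P o N x * g x ≤ B := by
    intro N
    rw [tsum_cesaro_mul]
    calc _ ≤ (N + 1 : ℝ≥0∞)⁻¹ * (V o + (N + 1 : ℕ) * B) := by
          gcongr
          exact le_add_self.trans (hd.sum_expect_law_le (N + 1))
      _ = B := by
          rw [hVo, zero_add, ← mul_assoc]
          push_cast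
          rw [natCast_add_one_mul_inv, one_mul]
  have hge1 : 1 ≤ ∑' x, ψ x := by
    -- Tightness by Markov's inequality: the averages put mass at most B/(K+1) outside the finite
    -- set where g ≤ K+1, and finite sums pass to the limit. So no mass escapes.
    have tight : ∀ K : ℕ, 1 ≤ ∑' x, ψ x + B * ((K + 1 : ℕ) : ℝ≥0∞)⁻¹ := by
      intro K
      set F := (hfin (K + 1)).toFinset with hF
      have hN : ∀ N, 1 ≤ ∑ x ∈ F, cesaro P o N x + B * ((K + 1 : ℕ) : ℝ≥0∞)⁻¹ := by
        intro N
        have hK0 : ((K + 1 : ℕ) : ℝ≥0∞) ≠ 0 := by simp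
        have hKt : ((K + 1 : ℕ) : ℝ≥0∞) ≠ ∞ := ENNReal.natCast_ne_top _
        calc 1 = ∑' x, cesaro P o N x := (tsum_cesaro o N).symm
          _ ≤ ∑' x, ((if x ∈ F then cesaro P o N x else 0)
                + cesaro P o N x * g x * ((K + 1 : ℕ) : ℝ≥0∞)⁻¹) := by
              refine ENNReal.tsum_le_tsum fun x => ?_
              by_cases hx : x ∈ F
              · rw [if_pos hx]; exact le_self_add
              · rw [if_neg hx, zero_add, mul_assoc]
                by_cases hc : cesaro P o N x = 0
                · simp [hc]
                · have hxa : Accessible P o x := by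
                    by_contra hn
                    refine hc ?_
                    rw [cesaro, Finset.sum_eq_zero, mul_zero]
                    intro k _
                    by_contra hk
                    exact hn (accessible_of_law_ne_zero hk)
                  have hg : ((K + 1 : ℕ) : ℝ≥0∞) ≤ g x := by
                    by_contra hlt
                    exact hx (by rw [hF, Set.Finite.mem_toFinset]; exact ⟨hxa, (not_le.1 hlt).le⟩)
                  calc cesaro P o N x = cesaro P o N x * 1 := (mul_one _).symm
                    _ ≤ _ := by
                      gcongr
                      rw [← ENNReal.mul_inv_cancel hK0 hKt]
                      gcongr
          _ = ∑ x ∈ F, cesaro P o N x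
                + (∑' x, cesaro P o N x * g x) * ((K + 1 : ℕ) : ℝ≥0∞)⁻¹ := by
              rw [ENNReal.tsum_add, ENNReal.tsum_mul_right]
              congr 1
              rw [tsum_eq_sum (s := F) fun x hx => if_neg hx]
              exact Finset.sum_congr rfl fun x hx => if_pos hx
          _ ≤ _ := by gcongr; exact hmean N
      have hl := (tendsto_finsetSum F fun x _ => hψ x).add_const (B * ((K + 1 : ℕ) : ℝ≥0∞)⁻¹)
      refine (ge_of_tendsto hl (Eventually.of_forall hN)).trans ?_
      gcongr
      exact ENNReal.sum_le_tsum F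
    have hl : Tendsto (fun K : ℕ => ∑' x, ψ x + B * ((K + 1 : ℕ) : ℝ≥0∞)⁻¹) atTop
        (𝓝 (∑' x, ψ x + B * 0)) :=
      (ENNReal.Tendsto.const_mul
        (ENNReal.tendsto_inv_nat_nhds_zero.comp (tendsto_add_atTop_nat 1)) (Or.inr hB)).const_add _
    have := ge_of_tendsto hl (Eventually.of_forall tight)
    simpa using this
  have hsum : ∑' x, ψ x = 1 := le_antisymm hle1 hge1
  -- Finite partial sums give only this inequality in the limit; both sides have total mass 1, which
  -- forces equality.
  have hstep : ∀ x, ∑' y, ψ y * P y x ≤ ψ x := by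
    intro x
    refine ENNReal.summable.tsum_le_of_sum_le fun F => ?_
    have h1 : Tendsto (fun N => ∑ y ∈ F, cesaro P o N y * P y x) U (𝓝 (∑ y ∈ F, ψ y * P y x)) :=
      tendsto_finsetSum F fun y _ =>
        ENNReal.Tendsto.mul_const (hψ y) (Or.inr ((P y).apply_ne_top x))
    have h2 := (hψ x).add hinv
    rw [add_zero] at h2
    exact le_of_tendsto_of_tendsto h1 h2 (Eventually.of_forall fun N =>
      (ENNReal.sum_le_tsum F).trans (cesaro_step_le o N x))
  have htot : ∑' x, ∑' y, ψ y * P y x = ∑' y, ψ y := by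
    rw [ENNReal.tsum_comm]
    refine tsum_congr fun y => ?_
    rw [ENNReal.tsum_mul_left, (P y).tsum_coe, mul_one]
  have heq := eq_of_le_of_tsum_le hstep (by rw [htot, hsum]; exact ENNReal.one_ne_top) htot.ge
  let Ψ : PMF S := ⟨ψ, hsum ▸ ENNReal.summable.hasSum⟩
  exact ⟨Ψ, PMF.ext fun x => (PMF.bind_apply Ψ P x).trans (congrFun heq x), fun x hx => hacc x hx⟩

end MarkovChain

namespace RandomMatching

/-! ### Random routing -/

section Split

variable {κ : Type} [Fintype κ] {w : κ → ℝ}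

theorem splitLaw_le {N : ℕ} {b : κ → ℕ} (hb : b ∈ (splitLaw w N).support) (k : κ) : b k ≤ N := by
  classical
  induction N generalizing b with
  | zero =>
    rw [splitLaw, PMF.support_pure, Set.mem_singleton_iff] at hb
    simp [hb]
  | succ N ih =>
    rw [splitLaw] at hb
    split_ifs at hb with h
    · rw [PMF.mem_support_bind_iff] at hb
      obtain ⟨l, -, hl⟩ := hb
      rw [PMF.mem_support_map_iff] at hl
      obtain ⟨b', hb', rfl⟩ := hl
      have h1 := ih hb'
      have h2 : (Pi.single l 1 : κ → ℕ) k ≤ 1 := by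
        by_cases hkl : k = l
        · simp [hkl]
        · simp [Pi.single_eq_of_ne hkl]
      simp only [Pi.add_apply]
      omega
    · rw [PMF.support_pure, Set.mem_singleton_iff] at hb
      simp [hb]

theorem splitLaw_eq_zero {N : ℕ} {b : κ → ℕ} (hb : b ∈ (splitLaw w N).support) {k : κ}
    (hk : w k ≤ 0) : b k = 0 := by
  classical
  induction N generalizing b with
  | zero =>
    rw [splitLaw, PMF.support_pure, Set.mem_singleton_iff] at hb
    simp [hb]
  | succ N ih =>
    rw [splitLaw] at hb
    split_ifs at hb with h
    · rw [PMF.mem_support_bind_iff] at hb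
      obtain ⟨l, hl', hl⟩ := hb
      rw [PMF.mem_support_map_iff] at hl
      obtain ⟨b', hb', rfl⟩ := hl
      rw [PMF.mem_support_normalize_iff] at hl'
      have hkl : k ≠ l := by
        rintro rfl
        exact hl' (ENNReal.ofReal_of_nonpos hk)
      simp [ih hb', Pi.single_eq_of_ne hkl]
    · rw [PMF.support_pure, Set.mem_singleton_iff] at hb
      simp [hb]

theorem sum_of_mem_splitLaw (h : ∑' k, ENNReal.ofReal (w k) ≠ 0) {N : ℕ} {b : κ → ℕ}
    (hb : b ∈ (splitLaw w N).support) : ∑ k, b k = N := by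
  classical
  induction N generalizing b with
  | zero =>
    rw [splitLaw, PMF.support_pure, Set.mem_singleton_iff] at hb
    simp [hb]
  | succ N ih =>
    rw [splitLaw, dif_pos h, PMF.mem_support_bind_iff] at hb
    obtain ⟨l, -, hl⟩ := hb
    rw [PMF.mem_support_map_iff] at hl
    obtain ⟨b', hb', rfl⟩ := hl
    simp [Finset.sum_add_distrib, ih hb']

/-- Each agent picks `k` with probability proportional to its weight, and expectations add.
Multiplying by the total weight keeps the identity free of division. -/
theorem expect_splitLaw_mul (h : ∑' k, ENNReal.ofReal (w k) ≠ 0) (N : ℕ) (k : κ) :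
    (expect (splitLaw w N) fun b => (b k : ℝ≥0∞)) * ∑' k, ENNReal.ofReal (w k) =
      N * ENNReal.ofReal (w k) := by
  classical
  induction N with
  | zero => simp [splitLaw, expect_pure]
  | succ N ih =>
    rw [splitLaw, dif_pos h, expect_bind]
    simp only [expect_map, Pi.add_apply, Nat.cast_add, expect_add, expect_const]
    rw [add_mul, ih, Nat.cast_one, add_mul, one_mul]
    congr 1
    unfold expect
    rw [tsum_eq_single k]
    · simp only [Pi.single_eq_same]
      rw [PMF.normalize_apply, Nat.cast_one, mul_one, mul_assoc, ENNReal.inv_mul_cancel h (sum_ofReal_ne_top w), mul_one]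
    · intro l hl
      simp [Pi.single_eq_of_ne hl.symm]

variable {T : Type*} {P : PMF T} {N : T → ℕ}

/-- If the mean number of agents is the total weight, then the mean numbers of agents that are
routed to the destinations are the weights. -/
theorem expect_splitLaw_of_mean
    (hN : (expect P fun a => (N a : ℝ≥0∞)) = ∑' k, ENNReal.ofReal (w k)) (k : κ) :
    (expect P fun a => expect (splitLaw w (N a)) fun b => (b k : ℝ≥0∞)) =
      ENNReal.ofReal (w k) := by
  by_cases h : ∑' k, ENNReal.ofReal (w k) = 0
  · have hk : ENNReal.ofReal (w k) = 0 := ENNReal.tsum_eq_zero.1 h k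
    have hk' : w k ≤ 0 := ENNReal.ofReal_eq_zero.1 hk
    rw [hk, ← expect_const P 0]
    refine expect_congr fun a _ => ?_
    rw [← expect_const (splitLaw w (N a)) 0]
    refine expect_congr fun b hb => ?_
    rw [splitLaw_eq_zero hb hk', Nat.cast_zero]
  · rw [← ENNReal.mul_left_inj h (sum_ofReal_ne_top w), ← expect_mul_right]
    simp only [expect_splitLaw_mul h]
    rw [expect_mul_right, hN, mul_comm]

/-- No agent is lost in routing. With zero total weight `splitLaw` routes nobody by default, but
then the mean of `N` is zero and almost surely no agent arrives. -/
theorem sum_splitLaw_of_mean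
    (hN : (expect P fun a => (N a : ℝ≥0∞)) = ∑' k, ENNReal.ofReal (w k)) {a : T}
    (ha : a ∈ P.support) {b : κ → ℕ} (hb : b ∈ (splitLaw w (N a)).support) :
    ∑ k, b k = N a := by
  by_cases h : ∑' k, ENNReal.ofReal (w k) = 0
  · have hNa : N a = 0 := by
      rw [h, expect, ENNReal.tsum_eq_zero] at hN
      rcases mul_eq_zero.1 (hN a) with h0 | h0
      · exact absurd h0 ha
      · exact_mod_cast h0
    refine (Finset.sum_eq_zero fun k _ => ?_).trans hNa.symm
    exact Nat.le_zero.1 (hNa ▸ splitLaw_le hb k)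
  · exact sum_of_mem_splitLaw h hb

end Split

section Indep

variable {τ κ : Type} [Fintype τ] [Fintype κ] (P : τ → PMF (κ → ℕ))

/-- The later estimates involve one server queue or one customer type at a time, so only the
marginals of the product law enter. -/
theorem map_indepLaw (t : τ) : (indepLaw P).map (fun b => b t) = P t := by
  rw [← PMF.toMeasure_inj, ← PMF.toMeasure_map _ _ (measurable_pi_apply t), indepLaw,
    Measure.toPMF_toMeasure]
  exact (measurePreserving_eval (fun t => (P t).toMeasure) t).map_eq

theorem expect_indepLaw (t : τ) (h : (κ → ℕ) → ℝ≥0∞) :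
    (expect (indepLaw P) fun b => h (b t)) = expect (P t) h := by
  rw [← map_indepLaw P t, expect_map]

theorem mem_support_of_mem_indepLaw {b : τ → κ → ℕ} (hb : b ∈ (indepLaw P).support) (t : τ) :
    b t ∈ (P t).support := by
  rw [← map_indepLaw P t, PMF.mem_support_map_iff]
  exact ⟨b, hb, rfl⟩

end Indep

variable {n m : ℕ} {χ : Fin n → Fin m → ℝ} {ε : ℝ} {q : SecState n m}
  {a : (Fin n → ℕ) × (Fin m → ℕ)}

theorem expect_routeLaw_server (i : Fin n) (h : (Fin m → ℕ) → ℝ≥0∞) :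
    (expect (routeLaw χ ε q a) fun b => h (b.1 i)) =
      expect (splitLaw (fun j => χ i j) (a.1 i)) h := by
  rw [routeLaw, expect_bind]
  simp only [expect_map, expect_const]
  exact expect_indepLaw (fun i => splitLaw (fun j => χ i j) (a.1 i)) i h

theorem expect_routeLaw_customer (j : Fin m) (h : (Fin n → ℕ) → ℝ≥0∞) :
    (expect (routeLaw χ ε q a) fun b => h (fun i => b.2 i j)) =
      expect (splitLaw (fun i => secRate χ ε q i j) (a.2 j)) h := by
  rw [routeLaw, expect_bind]
  simp only [expect_map]
  rw [expect_const]
  exact expect_indepLaw (fun j => splitLaw (fun i => secRate χ ε q i j) (a.2 j)) j h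

theorem mem_support_of_mem_routeLaw {b : SecState n m}
    (hb : b ∈ (routeLaw χ ε q a).support) :
    (∀ i, b.1 i ∈ (splitLaw (fun j => χ i j) (a.1 i)).support) ∧
      ∀ j, (fun i => b.2 i j) ∈ (splitLaw (fun i => secRate χ ε q i j) (a.2 j)).support := by
  rw [routeLaw, PMF.mem_support_bind_iff] at hb
  obtain ⟨b₁, hb₁, hb⟩ := hb
  rw [PMF.mem_support_map_iff] at hb
  obtain ⟨b₂, hb₂, rfl⟩ := hb
  exact ⟨mem_support_of_mem_indepLaw _ hb₁,
    mem_support_of_mem_indepLaw (fun j => splitLaw (fun i => secRate χ ε q i j) (a.2 j)) hb₂⟩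

/-! ### Two-price rates -/

theorem secRate_nonneg (hε : ∀ i j, 0 < χ i j → |ε| ≤ χ i j) (i : Fin n) (j : Fin m) :
    0 ≤ secRate χ ε q i j := by
  unfold secRate
  split_ifs with h h'
  · linarith [hε i j h, neg_abs_le ε]
  · linarith [hε i j h, le_abs_self ε]
  · exact le_rfl

theorem secRate_of_not_pos {i : Fin n} {j : Fin m} (h : ¬ 0 < χ i j) :
    secRate χ ε q i j = 0 := if_neg h

theorem abs_secRate_sub_le (hχ : ∀ i j, 0 ≤ χ i j) (i : Fin n) (j : Fin m) :
    |secRate χ ε q i j - χ i j| ≤ |ε| := by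
  unfold secRate
  split_ifs with h h'
  · simp
  · simp
  · rw [le_antisymm (not_lt.1 h) (hχ i j)]
    simp

/-- The multiple-price rate is the total of the routing weights, so proportional routing gives each
secondary queue exactly its own two-price rate. -/
theorem customerRate_eq_sum {lam : Fin m → ℝ} (hχ : ∀ i j, 0 ≤ χ i j)
    (hlam : ∀ j, lam j = ∑ i, χ i j) (j : Fin m) :
    customerRate lam χ ε q j = ∑ i, secRate χ ε q i j := by
  rw [customerRate, hlam j, Finset.mul_sum, Finset.mul_sum, ← Finset.sum_sub_distrib,
    ← Finset.sum_add_distrib]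
  refine Finset.sum_congr rfl fun i _ => ?_
  unfold secRate
  by_cases h : 0 < χ i j
  · by_cases h' : q.2 i j = 0
    · simp [h, h']
    · simp [h, h', Nat.pos_of_ne_zero h', sub_eq_add_neg]
  · simp [le_antisymm (not_lt.1 h) (hχ i j)]

end RandomMatching

/-! ### Mean arrivals and the law of one slot -/

theorem RealizesRates.expect_server {n m : ℕ} {P : PMF ((Fin n → ℕ) × (Fin m → ℕ))} {A : ℕ}
    {lam : Fin m → ℝ} {α : Measure (Fin n → ℝ)} (h : RealizesRates P A lam α) (i : Fin n) :
    (expect P fun a => (a.1 i : ℝ≥0∞)) = ENNReal.ofReal (∫ μ, μ i ∂α) := by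
  have hfin : (expect P fun a => (a.1 i : ℝ≥0∞)) ≠ ∞ := by
    refine ne_top_of_le_ne_top (ENNReal.natCast_ne_top A) ?_
    refine (expect_mono fun a ha => ?_).trans_eq (expect_const P (A : ℝ≥0∞))
    exact_mod_cast h.server_le a ha i
  rw [← h.server_mean i, tsum_toReal_mul_eq P fun a _ => Nat.cast_nonneg _]
  simp only [ENNReal.ofReal_natCast]
  rw [ENNReal.ofReal_toReal hfin]

theorem RealizesRates.expect_customer {n m : ℕ} {P : PMF ((Fin n → ℕ) × (Fin m → ℕ))} {A : ℕ}
    {lam : Fin m → ℝ} {α : Measure (Fin n → ℝ)} (h : RealizesRates P A lam α) (j : Fin m) :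
    (expect P fun a => (a.2 j : ℝ≥0∞)) = ENNReal.ofReal (lam j) := by
  have hfin : (expect P fun a => (a.2 j : ℝ≥0∞)) ≠ ∞ := by
    refine ne_top_of_le_ne_top (ENNReal.natCast_ne_top A) ?_
    refine (expect_mono fun a ha => ?_).trans_eq (expect_const P (A : ℝ≥0∞))
    exact_mod_cast h.customer_le a ha j
  rw [← h.customer_mean j, tsum_toReal_mul_eq P fun a _ => Nat.cast_nonneg _]
  simp only [ENNReal.ofReal_natCast]
  rw [ENNReal.ofReal_toReal hfin]

namespace RandomMatching

variable {n m : ℕ}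

/-! ### One slot of the policy -/

/-- Joint law of the arrivals and the secondary arrivals in a slot. -/
def slotArrivals (M : Market n m) (lam : Fin m → ℝ) (α : Measure (Fin n → ℝ))
    (χ : Fin n → Fin m → ℝ) (ε : ℝ) (q : SecState n m) :
    PMF (((Fin n → ℕ) × (Fin m → ℕ)) × SecState n m) :=
  (M.arrival (customerRate lam χ ε q) α).bind fun a => (routeLaw χ ε q a).map (Prod.mk a)

/-- Secondary queue lengths after the secondary arrivals `b` and the matches. -/
def nextState (χ : Fin n → Fin m → ℝ) (q b : SecState n m) : SecState n m :=
  (fun i j => q.1 i j + b.1 i j - secMatch χ q b i j,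
    fun i j => q.2 i j + b.2 i j - secMatch χ q b i j)

/-- Outcome of a slot with given arrivals and secondary arrivals. -/
def outcome (χ : Fin n → Fin m → ℝ) (q : SecState n m)
    (ab : ((Fin n → ℕ) × (Fin m → ℕ)) × SecState n m) : SlotOutcome n m (SecState n m) where
  a₁ := ab.1.1
  a₂ := ab.1.2
  y := secMatch χ q ab.2
  next := nextState χ q ab.2

/-- The parameters of a multiple-price policy that is implementable around `(lam, α, χ)`. -/
structure Admissible (M : Market n m) (lam : Fin m → ℝ) (α : Measure (Fin n → ℝ))
    (χ : Fin n → Fin m → ℝ) (ε : ℝ) (A : ℕ) : Prop where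
  prob : IsProbabilityMeasure α
  nonneg : ∀ i j, 0 ≤ χ i j
  compatible : ∀ i j, (i, j) ∉ M.E → χ i j = 0
  server_balance : ∀ i, ∫ μ, μ i ∂α = ∑ j, χ i j
  customer_balance : ∀ j, lam j = ∑ i, χ i j
  pos : 0 < ε
  le : ∀ i j, 0 < χ i j → ε ≤ χ i j
  realizes : ∀ q : SecState n m,
    RealizesRates (M.arrival (customerRate lam χ ε q) α) A (customerRate lam χ ε q) α

variable {M : Market n m} {lam : Fin m → ℝ} {α : Measure (Fin n → ℝ)}
  {χ : Fin n → Fin m → ℝ} {ε : ℝ} {A : ℕ} {q : SecState n m}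

/-- Transition law of the secondary queue lengths. -/
def stepLaw (M : Market n m) (lam : Fin m → ℝ) (α : Measure (Fin n → ℝ))
    (χ : Fin n → Fin m → ℝ) (ε : ℝ) (q : SecState n m) : PMF (SecState n m) :=
  (slotArrivals M lam α χ ε q).map fun ab => nextState χ q ab.2

/-- The explicit type in `@Eq` replaces the policy's state type by `SecState n m`, to which it
reduces by definition, so the chain can be studied without mentioning the policy. -/
theorem slot_policy (q : SecState n m) :
    @Eq (PMF (SlotOutcome n m (SecState n m))) ((policy M lam α χ ε).slot q)
      ((slotArrivals M lam α χ ε q).map (outcome χ q)) := by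
  rw [slotArrivals, PMF.map_bind]
  simp only [PMF.map_comp]
  rfl

theorem step_policy :
    @Eq (SecState n m → PMF (SecState n m)) (policy M lam α χ ε).step
      (stepLaw M lam α χ ε) := by
  funext q
  refine (congrArg (PMF.map SlotOutcome.next) (slot_policy q)).trans ?_
  exact PMF.map_comp _ _ _

theorem isSteadyState_iff {ψ : PMF (SecState n m)} : (policy M lam α χ ε).IsSteadyState ψ ↔
    MarkovChain.IsStationary (stepLaw M lam α χ ε) (0, 0) ψ :=
  iff_of_eq (congrArg (fun P : SecState n m → PMF (SecState n m) =>
    MarkovChain.IsStationary P (0, 0) ψ) step_policy)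

theorem isStable_iff : (policy M lam α χ ε).IsStable ↔
    MarkovChain.Stable (stepLaw M lam α χ ε) (0, 0) :=
  iff_of_eq (congrArg (fun P : SecState n m → PMF (SecState n m) =>
    MarkovChain.Stable P (0, 0)) step_policy)

theorem isIrreducible_iff : (policy M lam α χ ε).IsIrreducible ↔
    MarkovChain.IrreducibleFrom (stepLaw M lam α χ ε) (0, 0) :=
  iff_of_eq (congrArg (fun P : SecState n m → PMF (SecState n m) =>
    MarkovChain.IrreducibleFrom P (0, 0)) step_policy)

theorem expect_slotArrivals (h : ((Fin n → ℕ) × (Fin m → ℕ)) × SecState n m → ℝ≥0∞) :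
    expect (slotArrivals M lam α χ ε q) h =
      expect (M.arrival (customerRate lam χ ε q) α) fun a =>
        expect (routeLaw χ ε q a) fun b => h (a, b) := by
  rw [slotArrivals, expect_bind]
  simp only [expect_map]

theorem mem_slotArrivals {ab : ((Fin n → ℕ) × (Fin m → ℕ)) × SecState n m}
    (h : ab ∈ (slotArrivals M lam α χ ε q).support) :
    ab.1 ∈ (M.arrival (customerRate lam χ ε q) α).support ∧
      ab.2 ∈ (routeLaw χ ε q ab.1).support := by
  rw [slotArrivals, PMF.mem_support_bind_iff] at h
  obtain ⟨a, ha, h⟩ := h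
  rw [PMF.mem_support_map_iff] at h
  obtain ⟨b, hb, rfl⟩ := h
  exact ⟨ha, hb⟩

namespace Admissible

variable (H : Admissible M lam α χ ε A)
include H

theorem secRate_nonneg (i : Fin n) (j : Fin m) : 0 ≤ secRate χ ε q i j :=
  RandomMatching.secRate_nonneg (fun i j h => by rw [abs_of_pos H.pos]; exact H.le i j h) i j

theorem expect_server_arrivals (i : Fin n) :
    (expect (M.arrival (customerRate lam χ ε q) α) fun a => (a.1 i : ℝ≥0∞)) =
      ∑' j, ENNReal.ofReal (χ i j) := by
  rw [(H.realizes q).expect_server i, H.server_balance i, tsum_fintype,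
    ENNReal.ofReal_sum_of_nonneg fun j _ => H.nonneg i j]

theorem expect_customer_arrivals (j : Fin m) :
    (expect (M.arrival (customerRate lam χ ε q) α) fun a => (a.2 j : ℝ≥0∞)) =
      ∑' i, ENNReal.ofReal (secRate χ ε q i j) := by
  rw [(H.realizes q).expect_customer j, customerRate_eq_sum H.nonneg H.customer_balance,
    tsum_fintype, ENNReal.ofReal_sum_of_nonneg fun i _ => H.secRate_nonneg i j]

/-- Mean arrivals at a server queue equal the total routing weight there, so proportional routing
returns the weights themselves. The result does not depend on the state, which is what makes flow
balance exact. -/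
theorem expect_server (i : Fin n) (j : Fin m) :
    (expect (slotArrivals M lam α χ ε q) fun ab => (ab.2.1 i j : ℝ≥0∞)) =
      ENNReal.ofReal (χ i j) := by
  rw [expect_slotArrivals]
  simp only [expect_routeLaw_server i fun b => (b j : ℝ≥0∞)]
  exact expect_splitLaw_of_mean (w := fun j => χ i j) (H.expect_server_arrivals i) j

theorem expect_customer (i : Fin n) (j : Fin m) :
    (expect (slotArrivals M lam α χ ε q) fun ab => (ab.2.2 i j : ℝ≥0∞)) =
      ENNReal.ofReal (secRate χ ε q i j) := by
  rw [expect_slotArrivals]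
  simp only [expect_routeLaw_customer j fun b => (b i : ℝ≥0∞)]
  exact expect_splitLaw_of_mean (w := fun i => secRate χ ε q i j) (H.expect_customer_arrivals j) i

section Support

variable {ab : ((Fin n → ℕ) × (Fin m → ℕ)) × SecState n m}
  (hab : ab ∈ (slotArrivals M lam α χ ε q).support)
include hab

theorem sum_server (i : Fin n) : ∑ j, ab.2.1 i j = ab.1.1 i :=
  sum_splitLaw_of_mean (H.expect_server_arrivals i) (mem_slotArrivals hab).1
    ((mem_support_of_mem_routeLaw (mem_slotArrivals hab).2).1 i)

theorem sum_customer (j : Fin m) : ∑ i, ab.2.2 i j = ab.1.2 j :=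
  sum_splitLaw_of_mean (H.expect_customer_arrivals j) (mem_slotArrivals hab).1
    ((mem_support_of_mem_routeLaw (mem_slotArrivals hab).2).2 j)

theorem server_le (i : Fin n) (j : Fin m) : ab.2.1 i j ≤ A :=
  (splitLaw_le ((mem_support_of_mem_routeLaw (mem_slotArrivals hab).2).1 i) j).trans
    ((H.realizes q).server_le _ (mem_slotArrivals hab).1 i)

theorem customer_le (i : Fin n) (j : Fin m) : ab.2.2 i j ≤ A :=
  (splitLaw_le ((mem_support_of_mem_routeLaw (mem_slotArrivals hab).2).2 j) i).trans
    ((H.realizes q).customer_le _ (mem_slotArrivals hab).1 j)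

omit H in
theorem server_eq_zero {i : Fin n} {j : Fin m} (h : ¬ 0 < χ i j) : ab.2.1 i j = 0 :=
  splitLaw_eq_zero ((mem_support_of_mem_routeLaw (mem_slotArrivals hab).2).1 i) (not_lt.1 h)

omit H in
theorem customer_eq_zero {i : Fin n} {j : Fin m} (h : ¬ 0 < χ i j) : ab.2.2 i j = 0 :=
  splitLaw_eq_zero ((mem_support_of_mem_routeLaw (mem_slotArrivals hab).2).2 j)
    (k := i) (secRate_of_not_pos h).le

end Support

end Admissible

end RandomMatching

namespace RandomMatching

variable {n m : ℕ} {M : Market n m} {lam : Fin m → ℝ} {α : Measure (Fin n → ℝ)}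
  {χ : Fin n → Fin m → ℝ} {ε : ℝ} {A : ℕ} {q : SecState n m}

theorem secMatch_le_server (q b : SecState n m) (i : Fin n) (j : Fin m) :
    secMatch χ q b i j ≤ q.1 i j + b.1 i j := by
  unfold secMatch
  split_ifs
  · exact min_le_left _ _
  · exact Nat.zero_le _

theorem secMatch_le_customer (q b : SecState n m) (i : Fin n) (j : Fin m) :
    secMatch χ q b i j ≤ q.2 i j + b.2 i j := by
  unfold secMatch
  split_ifs
  · exact min_le_right _ _
  · exact Nat.zero_le _

theorem nextState_server_add (q b : SecState n m) (i : Fin n) (j : Fin m) :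
    (nextState χ q b).1 i j + secMatch χ q b i j = q.1 i j + b.1 i j :=
  Nat.sub_add_cancel (secMatch_le_server q b i j)

theorem nextState_customer_add (q b : SecState n m) (i : Fin n) (j : Fin m) :
    (nextState χ q b).2 i j + secMatch χ q b i j = q.2 i j + b.2 i j :=
  Nat.sub_add_cancel (secMatch_le_customer q b i j)

/-! ### Reachable states -/

/-- States in which unused pairs have empty secondary queues and no pair of secondary queues has
agents waiting on both sides. -/
def Matched (χ : Fin n → Fin m → ℝ) (q : SecState n m) : Prop :=
  ∀ i j, (¬ 0 < χ i j → q.1 i j = 0 ∧ q.2 i j = 0) ∧ (q.1 i j = 0 ∨ q.2 i j = 0)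

theorem matched_nextState (hq : Matched χ q)
    {ab : ((Fin n → ℕ) × (Fin m → ℕ)) × SecState n m}
    (hab : ab ∈ (slotArrivals M lam α χ ε q).support) : Matched χ (nextState χ q ab.2) := by
  intro i j
  have hsm := nextState_server_add (χ := χ) q ab.2 i j
  have hcm := nextState_customer_add (χ := χ) q ab.2 i j
  by_cases h : 0 < χ i j
  · refine ⟨fun h' => absurd h h', ?_⟩
    have : secMatch χ q ab.2 i j = min (q.1 i j + ab.2.1 i j) (q.2 i j + ab.2.2 i j) := if_pos h
    omega
  · obtain ⟨h1, h2⟩ := (hq i j).1 h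
    have h3 := Admissible.server_eq_zero hab h
    have h4 := Admissible.customer_eq_zero hab h
    exact ⟨fun _ => ⟨by omega, by omega⟩, Or.inl (by omega)⟩

theorem matched_of_accessible
    (h : MarkovChain.Accessible (stepLaw M lam α χ ε) (0, 0) q) : Matched χ q := by
  induction h with
  | refl => exact fun i j => ⟨fun _ => ⟨rfl, rfl⟩, Or.inl rfl⟩
  | @tail u v _ huv ih =>
    rw [stepLaw, PMF.mem_support_map_iff] at huv
    obtain ⟨ab, hab, rfl⟩ := huv
    exact matched_nextState ih hab

/-! ### Implementability -/

theorem mem_support_slot {q : SecState n m} {o : SlotOutcome n m (SecState n m)}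
    (ho : o ∈ ((policy M lam α χ ε).slot q).support) :
    ∃ ab ∈ (slotArrivals M lam α χ ε q).support, outcome χ q ab = o := by
  have h : o ∈ ((slotArrivals M lam α χ ε q).map (outcome χ q)).support := slot_policy q ▸ ho
  rwa [PMF.mem_support_map_iff] at h

theorem map_fst_slotArrivals :
    (slotArrivals M lam α χ ε q).map Prod.fst = M.arrival (customerRate lam χ ε q) α := by
  rw [slotArrivals, PMF.map_bind]
  simp only [PMF.map_comp]
  conv_rhs => rw [← PMF.bind_pure (M.arrival (customerRate lam χ ε q) α)]
  congr 1
  funext a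
  exact PMF.map_const _ _

theorem Admissible.isImplementable (H : Admissible M lam α χ ε A) :
    (policy M lam α χ ε).IsImplementable M where
  empty₁ _ := Finset.sum_const_zero (s := (Finset.univ : Finset (Fin m)))
  empty₂ _ := Finset.sum_const_zero (s := (Finset.univ : Finset (Fin n)))
  lam_nonneg q _ j := by
    refine le_of_le_of_eq ?_ (customerRate_eq_sum H.nonneg H.customer_balance j).symm
    exact Finset.sum_nonneg fun i _ => H.secRate_nonneg i j
  prob _ _ := H.prob
  arrivals q _ := by
    refine (congrArg (fun p : PMF (SlotOutcome n m (SecState n m)) =>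
      p.map fun o => (o.a₁, o.a₂)) (slot_policy q)).trans ?_
    refine (PMF.map_comp _ _ _).trans ?_
    exact map_fst_slotArrivals
  match_server q _ o ho i := by
    obtain ⟨ab, hab, rfl⟩ := mem_support_slot ho
    calc ∑ j, secMatch χ q ab.2 i j ≤ ∑ j, (q.1 i j + ab.2.1 i j) :=
          Finset.sum_le_sum fun j _ => secMatch_le_server q ab.2 i j
      _ = ∑ j, q.1 i j + ab.1.1 i := by rw [Finset.sum_add_distrib, H.sum_server hab i]
  match_customer q _ o ho j := by
    obtain ⟨ab, hab, rfl⟩ := mem_support_slot ho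
    calc ∑ i, secMatch χ q ab.2 i j ≤ ∑ i, (q.2 i j + ab.2.2 i j) :=
          Finset.sum_le_sum fun i _ => secMatch_le_customer q ab.2 i j
      _ = ∑ i, q.2 i j + ab.1.2 j := by rw [Finset.sum_add_distrib, H.sum_customer hab j]
  match_compatible q _ o ho i j hij := by
    obtain ⟨ab, hab, rfl⟩ := mem_support_slot ho
    exact if_neg (H.compatible i j hij).le.not_gt
  evolve_server q _ o ho i := by
    obtain ⟨ab, hab, rfl⟩ := mem_support_slot ho
    calc ∑ j, (nextState χ q ab.2).1 i j + ∑ j, secMatch χ q ab.2 i j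
        = ∑ j, (q.1 i j + ab.2.1 i j) := by
          rw [← Finset.sum_add_distrib]
          exact Finset.sum_congr rfl fun j _ => nextState_server_add q ab.2 i j
      _ = ∑ j, q.1 i j + ab.1.1 i := by rw [Finset.sum_add_distrib, H.sum_server hab i]
  evolve_customer q _ o ho j := by
    obtain ⟨ab, hab, rfl⟩ := mem_support_slot ho
    calc ∑ i, (nextState χ q ab.2).2 i j + ∑ i, secMatch χ q ab.2 i j
        = ∑ i, (q.2 i j + ab.2.2 i j) := by
          rw [← Finset.sum_add_distrib]
          exact Finset.sum_congr rfl fun i _ => nextState_customer_add q ab.2 i j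
      _ = ∑ i, q.2 i j + ab.1.2 j := by rw [Finset.sum_add_distrib, H.sum_customer hab j]

/-! ### Quadratic drift -/

/-- Here `x` agents wait on one side, `b` join them and `a` arrive opposite. After matching one side
is empty, so the squares sum to (x + b - a)² = x² + 2x(b - a) + (b - a)², with |b - a| ≤ A. The term
2xa stands on the left to avoid subtraction. -/
theorem sq_match_add_le {x a b A : ℕ} (ha : a ≤ A) (hb : b ≤ A) :
    (a - min a (x + b)) ^ 2 + (x + b - min a (x + b)) ^ 2 + 2 * x * a ≤
      x ^ 2 + 2 * x * b + A ^ 2 := by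
  rcases le_total a (x + b) with h | h
  · obtain ⟨c, hc⟩ := Nat.exists_eq_add_of_le h
    rw [min_eq_left h, Nat.sub_self, hc, Nat.add_sub_cancel_left]
    zify at *
    have hc' : (c : ℤ) = x + b - a := by linarith
    rw [hc']
    nlinarith [mul_nonneg (sub_nonneg.2 ha) (sub_nonneg.2 hb), Int.natCast_nonneg a,
      Int.natCast_nonneg b, mul_nonneg (Int.natCast_nonneg a) (sub_nonneg.2 ha),
      mul_nonneg (Int.natCast_nonneg b) (sub_nonneg.2 hb),
      mul_nonneg (Int.natCast_nonneg a) (Int.natCast_nonneg b)]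
  · obtain ⟨c, hc⟩ := Nat.exists_eq_add_of_le h
    rw [min_eq_right h, Nat.sub_self, hc, Nat.add_sub_cancel_left]
    zify at *
    nlinarith [mul_nonneg (sub_nonneg.2 ha) (sub_nonneg.2 hb), Int.natCast_nonneg c,
      Int.natCast_nonneg x, Int.natCast_nonneg b]

/-- Quadratic Lyapunov function. -/
def lyapunov (q : SecState n m) : ℝ≥0∞ :=
  ∑ i, ∑ j, ((q.1 i j : ℝ≥0∞) ^ 2 + (q.2 i j : ℝ≥0∞) ^ 2)

/-- Total number of waiting agents. -/
def total (q : SecState n m) : ℕ := ∑ i, ∑ j, q.1 i j + ∑ j, ∑ i, q.2 i j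

/-- Cancellation that turns the expected square inequality into a drift inequality. -/
theorem drift_cancel {E x B r s e : ℝ≥0∞} (hx : x ≠ ∞) (hs : s ≠ ∞)
    (h : E + 2 * x * r ≤ x ^ 2 + 2 * x * s + B) (hr : x ≠ 0 → r = s + e) :
    E + 2 * e * x ≤ x ^ 2 + B := by
  -- For x = 0 the rate terms vanish, so no relation between `r` and `s` is needed.
  by_cases h0 : x = 0
  · subst h0
    simpa using h
  · rw [hr h0] at h
    have hfin : 2 * x * s ≠ ∞ := by finiteness
    rw [← ENNReal.add_le_add_iff_left hfin]
    calc 2 * x * s + (E + 2 * e * x) = E + 2 * x * (s + e) := by ring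
      _ ≤ x ^ 2 + 2 * x * s + B := h
      _ = _ := by ring

/-- The nonempty side always receives ε fewer agents on average than the opposite side: χ - ε
customers against χ servers when customers wait, χ servers against χ + ε customers when servers
wait. The cross term of the square becomes -2ε times the length. -/
theorem Admissible.pair_drift (H : Admissible M lam α χ ε A) (hq : Matched χ q)
    (i : Fin n) (j : Fin m) :
    (expect (slotArrivals M lam α χ ε q) fun ab =>
        ((nextState χ q ab.2).1 i j : ℝ≥0∞) ^ 2 + ((nextState χ q ab.2).2 i j : ℝ≥0∞) ^ 2)
      + 2 * ENNReal.ofReal ε * (q.1 i j + q.2 i j : ℝ≥0∞) ≤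
      ((q.1 i j : ℝ≥0∞) ^ 2 + (q.2 i j : ℝ≥0∞) ^ 2) + (A : ℝ≥0∞) ^ 2 := by
  by_cases hχ : 0 < χ i j
  swap
  · obtain ⟨h1, h2⟩ := (hq i j).1 hχ
    rw [expect_congr (g := fun _ => 0), expect_const]
    · simp [h1, h2]
    · intro ab hab
      obtain ⟨h3, h4⟩ := (matched_nextState hq hab i j).1 hχ
      simp [h3, h4]
  have hsec : secRate χ ε q i j = χ i j + (if q.2 i j = 0 then ε else -ε) := if_pos hχ
  have hε := H.pos
  have hmatch : ∀ b : SecState n m,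
      secMatch χ q b i j = min (q.1 i j + b.1 i j) (q.2 i j + b.2 i j) := fun b => if_pos hχ
  have hn1 : ∀ b : SecState n m, (nextState χ q b).1 i j =
      q.1 i j + b.1 i j - min (q.1 i j + b.1 i j) (q.2 i j + b.2 i j) := fun b => by
    rw [← hmatch]; rfl
  have hn2 : ∀ b : SecState n m, (nextState χ q b).2 i j =
      q.2 i j + b.2 i j - min (q.1 i j + b.1 i j) (q.2 i j + b.2 i j) := fun b => by
    rw [← hmatch]; rfl
  rcases (hq i j).2 with h1 | h2
  · have key : (expect (slotArrivals M lam α χ ε q) fun ab =>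
        ((nextState χ q ab.2).1 i j : ℝ≥0∞) ^ 2 + ((nextState χ q ab.2).2 i j : ℝ≥0∞) ^ 2)
        + 2 * (q.2 i j : ℝ≥0∞) * ENNReal.ofReal (χ i j) ≤
        (q.2 i j : ℝ≥0∞) ^ 2 + 2 * (q.2 i j : ℝ≥0∞) * ENNReal.ofReal (secRate χ ε q i j)
          + (A : ℝ≥0∞) ^ 2 := by
      rw [← H.expect_server (q := q) i j, ← H.expect_customer (q := q) i j, ← expect_mul_left,
        ← expect_mul_left, ← expect_add]
      conv_rhs =>
        rw [← expect_const (slotArrivals M lam α χ ε q) ((q.2 i j : ℝ≥0∞) ^ 2),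
          ← expect_const (slotArrivals M lam α χ ε q) ((A : ℝ≥0∞) ^ 2), ← expect_add,
          ← expect_add]
      refine expect_mono fun ab hab => ?_
      have := sq_match_add_le (x := q.2 i j) (H.server_le hab i j) (H.customer_le hab i j)
      rw [hn1, hn2, h1, zero_add]
      exact_mod_cast this
    rw [h1, Nat.cast_zero, zero_add, zero_pow two_ne_zero, zero_add]
    refine drift_cancel (ENNReal.natCast_ne_top _) ENNReal.ofReal_ne_top key fun h0 => ?_
    have h0' : q.2 i j ≠ 0 := by exact_mod_cast h0
    rw [← ENNReal.ofReal_add (H.secRate_nonneg i j) hε.le, hsec, if_neg h0']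
    congr 1
    ring
  · have key : (expect (slotArrivals M lam α χ ε q) fun ab =>
        ((nextState χ q ab.2).1 i j : ℝ≥0∞) ^ 2 + ((nextState χ q ab.2).2 i j : ℝ≥0∞) ^ 2)
        + 2 * (q.1 i j : ℝ≥0∞) * ENNReal.ofReal (secRate χ ε q i j) ≤
        (q.1 i j : ℝ≥0∞) ^ 2 + 2 * (q.1 i j : ℝ≥0∞) * ENNReal.ofReal (χ i j)
          + (A : ℝ≥0∞) ^ 2 := by
      rw [← H.expect_server (q := q) i j, ← H.expect_customer (q := q) i j, ← expect_mul_left,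
        ← expect_mul_left, ← expect_add]
      conv_rhs =>
        rw [← expect_const (slotArrivals M lam α χ ε q) ((q.1 i j : ℝ≥0∞) ^ 2),
          ← expect_const (slotArrivals M lam α χ ε q) ((A : ℝ≥0∞) ^ 2), ← expect_add,
          ← expect_add]
      refine expect_mono fun ab hab => ?_
      have := sq_match_add_le (x := q.1 i j) (H.customer_le hab i j) (H.server_le hab i j)
      rw [hn1, hn2, h2, zero_add, min_comm, add_comm (_ ^ 2)]
      exact_mod_cast this
    rw [h2, Nat.cast_zero, add_zero, zero_pow two_ne_zero, add_zero]
    refine drift_cancel (ENNReal.natCast_ne_top _) ENNReal.ofReal_ne_top key fun h0 => ?_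
    rw [← ENNReal.ofReal_add (H.nonneg i j) hε.le, hsec, if_pos h2]

theorem Admissible.drift (H : Admissible M lam α χ ε A) :
    MarkovChain.Drift (stepLaw M lam α χ ε) (0, 0) lyapunov
      (fun q => 2 * ENNReal.ofReal ε * (total q : ℝ≥0∞)) (n * m * (A : ℝ≥0∞) ^ 2) := by
  intro q hq
  have hm := matched_of_accessible hq
  rw [stepLaw, expect_map]
  have h := Finset.sum_le_sum fun i (_ : i ∈ Finset.univ) =>
    Finset.sum_le_sum fun j (_ : j ∈ Finset.univ) => H.pair_drift hm i j
  simp only [Finset.sum_add_distrib, ← Finset.mul_sum, ← expect_finset_sum, Finset.sum_const,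
    Finset.card_univ, Fintype.card_fin, nsmul_eq_mul] at h
  have htot : (total q : ℝ≥0∞) = ∑ i, ∑ j, (q.1 i j : ℝ≥0∞) + ∑ i, ∑ j, (q.2 i j : ℝ≥0∞) := by
    rw [total, Finset.sum_comm (γ := Fin m)]
    push_cast
    rfl
  simp only [lyapunov, Finset.sum_add_distrib, htot]
  rw [mul_comm (n : ℝ≥0∞), mul_assoc (m : ℝ≥0∞)]
  exact h

theorem lyapunov_ne_top (q : SecState n m) : lyapunov q ≠ ∞ := by
  exact ENNReal.sum_ne_top.2 fun i _ => ENNReal.sum_ne_top.2 fun j _ => by finiteness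

theorem server_le_total (q : SecState n m) (i : Fin n) (j : Fin m) : q.1 i j ≤ total q :=
  calc q.1 i j ≤ ∑ j, q.1 i j :=
        Finset.single_le_sum (f := fun j => q.1 i j) (fun _ _ => Nat.zero_le _) (Finset.mem_univ j)
    _ ≤ ∑ i, ∑ j, q.1 i j := Finset.single_le_sum (f := fun i => ∑ j, q.1 i j)
        (fun _ _ => Nat.zero_le _) (Finset.mem_univ i)
    _ ≤ total q := Nat.le_add_right _ _

theorem customer_le_total (q : SecState n m) (i : Fin n) (j : Fin m) : q.2 i j ≤ total q :=
  calc q.2 i j ≤ ∑ i, q.2 i j :=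
        Finset.single_le_sum (f := fun i => q.2 i j) (fun _ _ => Nat.zero_le _) (Finset.mem_univ i)
    _ ≤ ∑ j, ∑ i, q.2 i j := Finset.single_le_sum (f := fun j => ∑ i, q.2 i j)
        (fun _ _ => Nat.zero_le _) (Finset.mem_univ j)
    _ ≤ total q := Nat.le_add_left _ _

theorem Admissible.exists_stationary (H : Admissible M lam α χ ε A) :
    ∃ ψ, MarkovChain.IsStationary (stepLaw M lam α χ ε) (0, 0) ψ := by
  refine H.drift.exists_stationary (by simp [lyapunov]) (by finiteness) fun K => ?_
  have he : 2 * ENNReal.ofReal ε ≠ 0 := by simp [H.pos]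
  have hfin : (K : ℝ≥0∞) / (2 * ENNReal.ofReal ε) ≠ ∞ :=
    ENNReal.div_ne_top (ENNReal.natCast_ne_top K) he
  obtain ⟨L, hL⟩ := ENNReal.exists_nat_gt hfin
  have hL' : {f : Fin n → Fin m → ℕ | ∀ i, f i ∈ {g : Fin m → ℕ | ∀ j, g j ∈ Set.Iic L}}.Finite :=
    Set.Finite.pi' fun _ => Set.Finite.pi' fun _ => Set.finite_Iic L
  refine (hL'.prod hL').subset fun q hq => ?_
  have htot : total q ≤ L := by
    have h1 : (total q : ℝ≥0∞) ≤ K / (2 * ENNReal.ofReal ε) := by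
      rw [ENNReal.le_div_iff_mul_le (Or.inl he) (Or.inl (by finiteness)), mul_comm]
      exact hq.2
    exact_mod_cast (h1.trans hL.le)
  exact ⟨fun i j => (server_le_total q i j).trans htot,
    fun i j => (customer_le_total q i j).trans htot⟩

end RandomMatching

/-! ### Taylor expansion of the revenue and averages of bounded functions -/

/-- Second-order Taylor estimate at a point where the function is twice continuously
differentiable. -/
theorem exists_taylor_bound {r : ℝ → ℝ} {x : ℝ} (hr : ContDiffAt ℝ 2 r x) :
    ∃ D K δ : ℝ, 0 ≤ K ∧ 0 < δ ∧ ∀ h, |h| < δ → |r (x + h) - r x - D * h| ≤ K * h ^ 2 := by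
  -- `K` is a local Lipschitz constant of the derivative. On the ball of radius |h| the derivative
  -- then varies by at most K|h|, and the mean value inequality supplies the second factor |h|.
  obtain ⟨K, t, ht, hK⟩ := (hr.fderiv_right (m := 1) (by norm_num)).exists_lipschitzOnWith
  have hd : ∀ᶠ y in 𝓝 x, DifferentiableAt ℝ r y :=
    (hr.eventually (by simp)).mono fun y hy => hy.differentiableAt (by norm_num)
  obtain ⟨δ, hδ, hball⟩ := Metric.eventually_nhds_iff.1 (hd.and (eventually_mem_set.2 ht))
  refine ⟨fderiv ℝ r x 1, K, δ, K.2, hδ, fun h hh => ?_⟩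
  have hs : ∀ y ∈ Metric.closedBall x |h|, dist y x < δ := fun y hy =>
    (Metric.mem_closedBall.1 hy).trans_lt hh
  have hx : x ∈ t := (hball (by simpa using hδ)).2
  have key := (convex_closedBall x |h|).norm_image_sub_le_of_norm_fderiv_le'
    (f := r) (φ := fderiv ℝ r x) (C := K * |h|) (x := x) (y := x + h) (𝕜 := ℝ)
    (fun y hy => (hball (hs y hy)).1)
    (fun y hy => by
      refine (hK.norm_sub_le (hball (hs y hy)).2 hx).trans ?_
      gcongr
      exact mem_closedBall_iff_norm.1 hy)
    (by simp) (by simp [Metric.mem_closedBall, dist_eq_norm])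
  rw [add_sub_cancel_left, Real.norm_eq_abs, Real.norm_eq_abs] at key
  have hlin : fderiv ℝ r x h = fderiv ℝ r x 1 * h := by
    simp [mul_comm]
  rw [hlin] at key
  refine key.trans_eq ?_
  rw [mul_assoc, abs_mul_abs_self, sq]

/-- At x = 0 smoothness is only one-sided. The side condition disposes of this case: a type with
zero fluid rate has no active secondary queue, and its rate is never perturbed. -/
theorem Market.exists_revenue_bound {n m : ℕ} (M : Market n m) {x : ℝ} (hx : 0 ≤ x) (j : Fin m) :
    ∃ D K δ : ℝ, 0 ≤ K ∧ 0 < δ ∧ ∀ h, (x = 0 → h = 0) → |h| < δ →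
      |M.F j (x + h) * (x + h) - M.F j x * x - D * h| ≤ K * h ^ 2 := by
  rcases hx.eq_or_lt with rfl | hx
  · refine ⟨0, 0, 1, le_rfl, one_pos, fun h hh _ => ?_⟩
    simp [hh rfl]
  · have hF : ContDiffAt ℝ 2 (M.F j) x := (M.F_contDiff j).contDiffAt (Ici_mem_nhds hx)
    obtain ⟨D, K, δ, hK, hδ, h⟩ := exists_taylor_bound (hF.mul contDiffAt_id)
    exact ⟨D, K, δ, hK, hδ, fun h' _ hh => h h' hh⟩

theorem summable_toReal_mul_of_bounded {S : Type*} (p : PMF S) {f : S → ℝ} {c : ℝ}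
    (hf : ∀ x, |f x| ≤ c) : Summable fun x => (p x).toReal * f x := by
  have hp : Summable fun x => (p x).toReal := ENNReal.summable_toReal p.tsum_coe_ne_top
  refine Summable.of_norm_bounded (hp.mul_right c) fun x => ?_
  rw [norm_mul, Real.norm_of_nonneg ENNReal.toReal_nonneg, Real.norm_eq_abs]
  exact mul_le_mul_of_nonneg_left (hf x) ENNReal.toReal_nonneg

theorem tsum_toReal_mul_const {S : Type*} (p : PMF S) (c : ℝ) :
    ∑' x, (p x).toReal * c = c := by
  rw [tsum_mul_right, ← ENNReal.tsum_toReal_eq p.apply_ne_top, p.tsum_coe, ENNReal.toReal_one,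
    one_mul]

theorem abs_tsum_toReal_mul_le {S : Type*} (p : PMF S) {f : S → ℝ} {c : ℝ}
    (hf : ∀ x, |f x| ≤ c) : |∑' x, (p x).toReal * f x| ≤ c := by
  have hs := summable_toReal_mul_of_bounded p hf
  have hc : Summable fun x => (p x).toReal * c :=
    (ENNReal.summable_toReal p.tsum_coe_ne_top).mul_right c
  have h := tsum_toReal_mul_const p
  rw [abs_le]
  constructor
  · rw [← h (-c)]
    refine Summable.tsum_le_tsum (fun x => ?_) (by simpa using hc.neg) hs
    exact mul_le_mul_of_nonneg_left (abs_le.1 (hf x)).1 ENNReal.toReal_nonneg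
  · rw [← h c]
    refine Summable.tsum_le_tsum (fun x => ?_) hs hc
    exact mul_le_mul_of_nonneg_left (abs_le.1 (hf x)).2 ENNReal.toReal_nonneg

namespace RandomMatching

variable {n m : ℕ} {M : Market n m} {lam : Fin m → ℝ} {α : Measure (Fin n → ℝ)}
  {χ : Fin n → Fin m → ℝ} {ε : ℝ} {A : ℕ} {q : SecState n m}

/-! ### Steady state -/

theorem matchRate_policy (ψ : PMF (SecState n m)) (i : Fin n) (j : Fin m) :
    (policy M lam α χ ε).matchRate ψ i j =
      expect ψ fun q => expect (slotArrivals M lam α χ ε q) fun ab =>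
        (secMatch χ q ab.2 i j : ℝ≥0∞) := by
  have h : ∀ q : SecState n m,
      expect ((policy M lam α χ ε).slot q) (fun o => (o.y i j : ℝ≥0∞)) =
        expect (slotArrivals M lam α χ ε q) fun ab => (secMatch χ q ab.2 i j : ℝ≥0∞) := by
    intro q
    refine (congrArg (fun p : PMF (SlotOutcome n m (SecState n m)) =>
      expect p fun o => (o.y i j : ℝ≥0∞)) (slot_policy q)).trans ?_
    exact expect_map _ _ _
  simp only [← h]
  rfl

namespace Admissible

variable (H : Admissible M lam α χ ε A) {ψ : PMF (SecState n m)}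
  (hψ : MarkovChain.IsStationary (stepLaw M lam α χ ε) (0, 0) ψ)
include H hψ

/-- The stationary drift bound divided by 2ε: the 1/ε half of the trade-off. -/
theorem expect_total_le :
    (expect ψ fun q => (total q : ℝ≥0∞)) ≤ ENNReal.ofReal (n * m * A ^ 2 / (2 * ε)) := by
  have h := H.drift.expect_le lyapunov_ne_top hψ
  have hε := H.pos
  rw [expect_mul_left] at h
  have h2 : 2 * ENNReal.ofReal ε = ENNReal.ofReal (2 * ε) := by
    rw [ENNReal.ofReal_mul zero_le_two, ENNReal.ofReal_ofNat]
  have h3 : (n * m * A ^ 2 : ℝ≥0∞) = ENNReal.ofReal (n * m * A ^ 2 : ℝ) := by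
    have : (n * m * A ^ 2 : ℝ) = ((n * m * A ^ 2 : ℕ) : ℝ) := by push_cast; rfl
    rw [this, ENNReal.ofReal_natCast]
    push_cast
    rfl
  rw [h2, h3] at h
  rw [ENNReal.ofReal_div_of_pos (by positivity), ENNReal.le_div_iff_mul_le
    (Or.inl (by simp [hε])) (Or.inl ENNReal.ofReal_ne_top), mul_comm]
  exact h

theorem expect_total_ne_top : (expect ψ fun q => (total q : ℝ≥0∞)) ≠ ∞ :=
  ne_top_of_le_ne_top ENNReal.ofReal_ne_top (H.expect_total_le hψ)

/-- Flow balance for servers: a stationary queue of finite mean length has equal mean inflow and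
outflow, and the inflow is χ in every state. Finiteness is what allows the mean length to be
cancelled. -/
theorem matchRate_eq (i : Fin n) (j : Fin m) :
    (policy M lam α χ ε).matchRate ψ i j = ENNReal.ofReal (χ i j) := by
  have hfin : (expect ψ fun q => (q.1 i j : ℝ≥0∞)) ≠ ∞ :=
    ne_top_of_le_ne_top (H.expect_total_ne_top hψ)
      (expect_mono fun q _ => by exact_mod_cast server_le_total q i j)
  rw [matchRate_policy, ← ENNReal.add_right_inj hfin]
  conv_lhs => rw [← MarkovChain.expect_step_of_bind_eq hψ.1 fun q => (q.1 i j : ℝ≥0∞)]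
  conv_rhs => rw [← expect_const ψ (ENNReal.ofReal (χ i j))]
  rw [← expect_add, ← expect_add]
  refine expect_congr fun q _ => ?_
  rw [stepLaw, expect_map, ← expect_add, ← H.expect_server (q := q) i j]
  conv_rhs => rw [← expect_const (slotArrivals M lam α χ ε q) (q.1 i j : ℝ≥0∞), ← expect_add]
  refine expect_congr fun ab _ => ?_
  exact_mod_cast nextState_server_add q ab.2 i j

/-- Flow balance for customers: their mean inflow equals the matching rate, already known to be χ.
The perturbations ±ε therefore cancel in stationary mean. -/
theorem expect_secRate (i : Fin n) (j : Fin m) :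
    (expect ψ fun q => ENNReal.ofReal (secRate χ ε q i j)) = ENNReal.ofReal (χ i j) := by
  have hfin : (expect ψ fun q => (q.2 i j : ℝ≥0∞)) ≠ ∞ :=
    ne_top_of_le_ne_top (H.expect_total_ne_top hψ)
      (expect_mono fun q _ => by exact_mod_cast customer_le_total q i j)
  rw [← H.matchRate_eq hψ i j, matchRate_policy, ← ENNReal.add_right_inj hfin]
  conv_rhs => rw [← MarkovChain.expect_step_of_bind_eq hψ.1 fun q => (q.2 i j : ℝ≥0∞)]
  rw [← expect_add, ← expect_add]
  refine expect_congr fun q _ => ?_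
  rw [stepLaw, expect_map, ← expect_add, ← H.expect_customer (q := q) i j]
  conv_lhs => rw [← expect_const (slotArrivals M lam α χ ε q) (q.2 i j : ℝ≥0∞), ← expect_add]
  refine expect_congr fun ab _ => ?_
  exact_mod_cast (nextState_customer_add q ab.2 i j).symm

theorem rates_eq : (policy M lam α χ ε).rates ψ = χ := by
  funext i j
  exact (congrArg ENNReal.toReal (H.matchRate_eq hψ i j)).trans
    (ENNReal.toReal_ofReal (H.nonneg i j))

theorem tsum_secRate_sub (i : Fin n) (j : Fin m) :
    Summable (fun q => (ψ q).toReal * (secRate χ ε q i j - χ i j)) ∧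
      ∑' q, (ψ q).toReal * (secRate χ ε q i j - χ i j) = 0 := by
  have hs := summable_toReal_mul_of_bounded ψ
    (f := fun q => secRate χ ε q i j - χ i j) fun q => abs_secRate_sub_le H.nonneg i j
  refine ⟨hs, ?_⟩
  have hc : Summable fun q => (ψ q).toReal * χ i j :=
    (ENNReal.summable_toReal ψ.tsum_coe_ne_top).mul_right _
  have h1 : ∑' q, (ψ q).toReal * secRate χ ε q i j = χ i j := by
    rw [tsum_toReal_mul_eq ψ fun q _ => H.secRate_nonneg i j, H.expect_secRate hψ i j,
      ENNReal.toReal_ofReal (H.nonneg i j)]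
  have h2 := hs.tsum_add hc
  rw [tsum_toReal_mul_const] at h2
  have h3 : ∑' q, ((ψ q).toReal * (secRate χ ε q i j - χ i j) + (ψ q).toReal * χ i j) = χ i j := by
    rw [← h1]
    exact tsum_congr fun q => by rw [h1]; ring
  linarith

omit hψ in
theorem customerRate_sub (q : SecState n m) (j : Fin m) :
    customerRate lam χ ε q j - lam j = ∑ i, (secRate χ ε q i j - χ i j) := by
  rw [customerRate_eq_sum H.nonneg H.customer_balance, H.customer_balance j,
    Finset.sum_sub_distrib]

omit hψ in
theorem abs_customerRate_sub_le (q : SecState n m) (j : Fin m) :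
    |customerRate lam χ ε q j - lam j| ≤ n * ε := by
  rw [H.customerRate_sub]
  refine (Finset.abs_sum_le_sum_abs _ _).trans ?_
  refine (Finset.sum_le_sum fun i _ => abs_secRate_sub_le H.nonneg i j).trans_eq ?_
  simp [abs_of_pos H.pos]

omit hψ in
theorem customerRate_sub_eq_zero (q : SecState n m) {j : Fin m} (hj : lam j = 0) :
    customerRate lam χ ε q j - lam j = 0 := by
  rw [H.customerRate_sub]
  rw [H.customer_balance j, Finset.sum_eq_zero_iff_of_nonneg fun i _ => H.nonneg i j] at hj
  refine Finset.sum_eq_zero fun i hi => ?_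
  rw [secRate_of_not_pos (hj i hi).le.not_gt, hj i hi, sub_zero]

/-- Kills the first-order term of the revenue expansion; without this the loss would be of order ηε.
-/
theorem tsum_customerRate_sub (D : Fin m → ℝ) :
    Summable (fun q => (ψ q).toReal * ∑ j, D j * (customerRate lam χ ε q j - lam j)) ∧
      ∑' q, (ψ q).toReal * ∑ j, D j * (customerRate lam χ ε q j - lam j) = 0 := by
  have h : HasSum (fun q => ∑ j, ∑ i, D j * ((ψ q).toReal * (secRate χ ε q i j - χ i j)))
      (∑ j : Fin m, ∑ _i : Fin n, D j * 0) := by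
    refine hasSum_sum fun j _ => hasSum_sum fun i _ => HasSum.mul_left _ ?_
    have := H.tsum_secRate_sub hψ i j
    exact this.2 ▸ this.1.hasSum
  simp only [mul_zero, Finset.sum_const_zero] at h
  have e : (fun q => (ψ q).toReal * ∑ j, D j * (customerRate lam χ ε q j - lam j)) =
      fun q => ∑ j, ∑ i, D j * ((ψ q).toReal * (secRate χ ε q i j - χ i j)) := by
    funext q
    rw [Finset.mul_sum]
    refine Finset.sum_congr rfl fun j _ => ?_
    rw [H.customerRate_sub, ← Finset.mul_sum, ← Finset.mul_sum]
    ring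
  rw [e]
  exact ⟨h.summable, h.tsum_eq⟩

end Admissible

end RandomMatching

/-- Optimality bounds the set of profits, so `sSup` is an attained maximum and not a default value.
-/
theorem Market.IsFluidOptimal.fluidValue_eq {n m : ℕ} {M : Market n m} {lam : Fin m → ℝ}
    {α : Measure (Fin n → ℝ)} {χ : Fin n → Fin m → ℝ} (h : M.IsFluidOptimal lam α χ) :
    M.fluidValue = M.fluidProfit lam α χ := by
  refine IsGreatest.csSup_eq ⟨⟨lam, α, χ, h.1, rfl⟩, ?_⟩
  rintro _ ⟨lam', α', χ', h', rfl⟩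
  exact h.2 lam' α' χ' h'

namespace RandomMatching

variable {n m : ℕ} {M : Market n m} {lam : Fin m → ℝ} {α : Measure (Fin n → ℝ)}
  {χ : Fin n → Fin m → ℝ} {ε : ℝ} {A : ℕ}

/-! ### Net profit -/

theorem penalty_nonneg (q : SecState n m) : 0 ≤ (policy M lam α χ ε).penalty M q :=
  add_nonneg (Finset.sum_nonneg fun i _ => mul_nonneg (M.s₁_nonneg i) (Nat.cast_nonneg _))
    (Finset.sum_nonneg fun j _ => mul_nonneg (M.s₂_nonneg j) (Nat.cast_nonneg _))

theorem penalty_le (q : SecState n m) :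
    (policy M lam α χ ε).penalty M q ≤ (∑ i, M.s₁ i + ∑ j, M.s₂ j) * total q := by
  have h1 : ∀ i, ∑ j, q.1 i j ≤ total q := fun i =>
    (Finset.single_le_sum (f := fun i => ∑ j, q.1 i j)
      (fun _ _ => Nat.zero_le _) (Finset.mem_univ i)).trans (Nat.le_add_right _ _)
  have h2 : ∀ j, ∑ i, q.2 i j ≤ total q := fun j =>
    (Finset.single_le_sum (f := fun j => ∑ i, q.2 i j)
      (fun _ _ => Nat.zero_le _) (Finset.mem_univ j)).trans (Nat.le_add_left _ _)
  rw [add_mul, Finset.sum_mul, Finset.sum_mul]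
  refine add_le_add (Finset.sum_le_sum fun i _ => ?_) (Finset.sum_le_sum fun j _ => ?_)
  · exact mul_le_mul_of_nonneg_left (Nat.cast_le.2 (h1 i)) (M.s₁_nonneg i)
  · exact mul_le_mul_of_nonneg_left (Nat.cast_le.2 (h2 j)) (M.s₂_nonneg j)

theorem penaltyWeight_nonneg (M : Market n m) : 0 ≤ ∑ i, M.s₁ i + ∑ j, M.s₂ j :=
  add_nonneg (Finset.sum_nonneg fun i _ => M.s₁_nonneg i)
    (Finset.sum_nonneg fun j _ => M.s₂_nonneg j)

namespace Admissible

variable (H : Admissible M lam α χ ε A) {ψ : PMF (SecState n m)}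
  (hψ : MarkovChain.IsStationary (stepLaw M lam α χ ε) (0, 0) ψ)
include H hψ

theorem expect_penalty_le :
    (expect ψ fun q => ENNReal.ofReal ((policy M lam α χ ε).penalty M q)) ≤
      ENNReal.ofReal ((∑ i, M.s₁ i + ∑ j, M.s₂ j) * (n * m * A ^ 2 / (2 * ε))) := by
  have hS := penaltyWeight_nonneg M
  rw [ENNReal.ofReal_mul hS]
  refine le_trans ?_ (mul_le_mul_right (H.expect_total_le hψ) _)
  rw [← expect_mul_left]
  refine expect_mono fun q _ => ?_
  rw [← ENNReal.ofReal_natCast, ← ENNReal.ofReal_mul hS]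
  exact ENNReal.ofReal_le_ofReal (penalty_le q)

theorem summable_penalty :
    Summable fun q => (ψ q).toReal * (policy M lam α χ ε).penalty M q :=
  summable_toReal_mul ψ (fun q _ => penalty_nonneg q)
    (ne_top_of_le_ne_top ENNReal.ofReal_ne_top (H.expect_penalty_le hψ))

theorem abs_tsum_penalty_le :
    |∑' q, (ψ q).toReal * (policy M lam α χ ε).penalty M q| ≤
      (∑ i, M.s₁ i + ∑ j, M.s₂ j) * (n * m * A ^ 2 / (2 * ε)) := by
  have hε := H.pos
  have hS := penaltyWeight_nonneg M
  rw [tsum_toReal_mul_eq ψ fun q _ => penalty_nonneg q, abs_of_nonneg ENNReal.toReal_nonneg]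
  exact ENNReal.toReal_le_of_le_ofReal (by positivity) (H.expect_penalty_le hψ)

section Profit

variable {D K δ : Fin m → ℝ} (hK : ∀ j, 0 ≤ K j) (hδ : ∀ j, n * ε < δ j)
  (hr : ∀ j h, (lam j = 0 → h = 0) → |h| < δ j →
    |M.F j (lam j + h) * (lam j + h) - M.F j (lam j) * lam j - D j * h| ≤ K j * h ^ 2)
include hK hδ hr

/-- The actual matching rates equal χ, so the cost integral is the fluid cost and cancels; only the
quadratic Taylor remainders of the revenues are left. -/
theorem abs_slotProfit_sub_le (q : SecState n m) :
    |(policy M lam α χ ε).slotProfit M ψ q - M.fluidProfit lam α χ -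
        ∑ j, D j * (customerRate lam χ ε q j - lam j)| ≤ (∑ j, K j) * (n * ε) ^ 2 := by
  have hval : (policy M lam α χ ε).slotProfit M ψ q =
      ∑ j, M.F j (customerRate lam χ ε q j) * customerRate lam χ ε q j -
        ∫ μ, M.cost μ χ ∂α := by
    have : (policy M lam α χ ε).slotProfit M ψ q =
      ∑ j, M.F j (customerRate lam χ ε q j) * customerRate lam χ ε q j -
        ∫ μ, M.cost μ ((policy M lam α χ ε).rates ψ) ∂α := rfl
    rw [this, H.rates_eq hψ]
  have e : (policy M lam α χ ε).slotProfit M ψ q - M.fluidProfit lam α χ -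
        ∑ j, D j * (customerRate lam χ ε q j - lam j) =
      ∑ j, (M.F j (customerRate lam χ ε q j) * customerRate lam χ ε q j -
        M.F j (lam j) * lam j - D j * (customerRate lam χ ε q j - lam j)) := by
    rw [hval, Market.fluidProfit, Finset.sum_sub_distrib, Finset.sum_sub_distrib]
    ring
  rw [e, Finset.sum_mul]
  refine (Finset.abs_sum_le_sum_abs _ _).trans (Finset.sum_le_sum fun j _ => ?_)
  have hle := H.abs_customerRate_sub_le q j
  have h := hr j (customerRate lam χ ε q j - lam j) (H.customerRate_sub_eq_zero q)
    (hle.trans_lt (hδ j))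
  rw [add_sub_cancel] at h
  refine h.trans (mul_le_mul_of_nonneg_left ?_ (hK j))
  exact sq_le_sq' (by linarith [(abs_le.1 hle).1]) (abs_le.1 hle).2

theorem summable_slotProfit_and_abs_tsum_sub_le :
    Summable (fun q => (ψ q).toReal * (policy M lam α χ ε).slotProfit M ψ q) ∧
      |∑' q, (ψ q).toReal * (policy M lam α χ ε).slotProfit M ψ q - M.fluidProfit lam α χ| ≤
        (∑ j, K j) * (n * ε) ^ 2 := by
  have hb := H.abs_slotProfit_sub_le hψ hK hδ hr
  have s1 := summable_toReal_mul_of_bounded ψ hb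
  obtain ⟨s2, t2⟩ := H.tsum_customerRate_sub hψ D
  have s3 : Summable fun q => (ψ q).toReal * M.fluidProfit lam α χ :=
    (ENNReal.summable_toReal ψ.tsum_coe_ne_top).mul_right _
  -- Splits the profit into a bounded quadratic remainder, a linear term of mean zero and the
  -- constant fluid profit.
  have e : (fun q => (ψ q).toReal * (policy M lam α χ ε).slotProfit M ψ q) = fun q =>
      (ψ q).toReal * ((policy M lam α χ ε).slotProfit M ψ q - M.fluidProfit lam α χ -
        ∑ j, D j * (customerRate lam χ ε q j - lam j)) +
      (ψ q).toReal * (∑ j, D j * (customerRate lam χ ε q j - lam j)) +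
      (ψ q).toReal * M.fluidProfit lam α χ := by
    funext q
    ring
  refine ⟨e ▸ (s1.add s2).add s3, ?_⟩
  rw [e, (s1.add s2).tsum_add s3, s1.tsum_add s2, t2, tsum_toReal_mul_const, add_zero,
    add_sub_cancel_right]
  exact abs_tsum_toReal_mul_le ψ hb

theorem abs_netProfitLoss_le (hopt : M.IsFluidOptimal lam α χ) {η : ℝ} (hη : 0 ≤ η) :
    |(policy M lam α χ ε).netProfitLoss M η ψ| ≤ η * ((∑ j, K j) * (n * ε) ^ 2) +
      (∑ i, M.s₁ i + ∑ j, M.s₂ j) * (n * m * A ^ 2 / (2 * ε)) := by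
  have hloss : (policy M lam α χ ε).netProfitLoss M η ψ =
      -(η * (∑' q, (ψ q).toReal * (policy M lam α χ ε).slotProfit M ψ q -
        M.fluidProfit lam α χ)) +
      ∑' q, (ψ q).toReal * (policy M lam α χ ε).penalty M q := by
    change η * M.fluidValue - (η * ∑' q, (ψ q).toReal * (policy M lam α χ ε).slotProfit M ψ q -
      ∑' q, (ψ q).toReal * (policy M lam α χ ε).penalty M q) = _
    rw [hopt.fluidValue_eq]
    ring
  rw [hloss]
  refine (abs_add_le _ _).trans ?_
  rw [abs_neg, abs_mul, abs_of_nonneg hη]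
  exact add_le_add (mul_le_mul_of_nonneg_left
    (H.summable_slotProfit_and_abs_tsum_sub_le hψ hK hδ hr).2 hη) (H.abs_tsum_penalty_le hψ)

end Profit

end Admissible

/-! ### Small perturbations are admissible -/

/-- All customer rates of the policy lie within nε of λ⋆ and are nonnegative once ε is below every
positive χ, so for small ε they fall in the neighbourhood where the arrival assumption holds. -/
theorem eventually_admissible (hfeas : M.FluidFeasible lam α χ)
    (harr : ∀ᶠ lam' in 𝓝[Set.Ici 0] lam, RealizesRates (M.arrival lam' α) A lam' α) :
    ∀ᶠ ε : ℝ in 𝓝[>] 0, Admissible M lam α χ ε A := by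
  obtain ⟨δ, hδ, hball⟩ := Metric.mem_nhdsWithin_iff.1 harr
  have h1 : ∀ᶠ ε : ℝ in 𝓝[>] 0, ∀ i j, 0 < χ i j → ε ≤ χ i j := by
    refine eventually_all.2 fun i => eventually_all.2 fun j => ?_
    by_cases h : 0 < χ i j
    · filter_upwards [nhdsWithin_le_nhds (Iic_mem_nhds h)] with ε hε _ using hε
    · exact Eventually.of_forall fun ε h' => absurd h' h
  have h2 : ∀ᶠ ε : ℝ in 𝓝[>] 0, n * ε < δ := by
    have : Tendsto (fun ε : ℝ => n * ε) (𝓝[>] 0) (𝓝 (n * 0)) :=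
      (tendsto_id.mono_left nhdsWithin_le_nhds).const_mul _
    rw [mul_zero] at this
    exact this.eventually_lt_const hδ
  filter_upwards [h1, h2, self_mem_nhdsWithin] with ε hχ hε hpos
  have hpos : 0 < ε := hpos
  refine ⟨hfeas.prob, hfeas.nonneg, hfeas.compatible, hfeas.server_balance,
    hfeas.customer_balance, hpos, hχ, fun q => hball ⟨?_, fun j => ?_⟩⟩
  · rw [Metric.mem_ball, dist_pi_lt_iff hδ]
    intro j
    rw [Real.dist_eq, customerRate_eq_sum hfeas.nonneg hfeas.customer_balance,
      hfeas.customer_balance j, ← Finset.sum_sub_distrib]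
    refine lt_of_le_of_lt ?_ hε
    refine (Finset.abs_sum_le_sum_abs _ _).trans ?_
    refine (Finset.sum_le_sum fun i _ => abs_secRate_sub_le hfeas.nonneg i j).trans_eq ?_
    simp [abs_of_pos hpos]
  · rw [customerRate_eq_sum hfeas.nonneg hfeas.customer_balance]
    exact Finset.sum_nonneg fun i _ =>
      secRate_nonneg (fun i j h => by rw [abs_of_pos hpos]; exact hχ i j h) i j

end RandomMatching

/-! ### The main theorem: balancing the two losses -/

open RandomMatching in
theorem mainTheorem9 {n m : ℕ} (M : Market n m)
    (lam : Fin m → ℝ) (α : Measure (Fin n → ℝ)) (χ : Fin n → Fin m → ℝ)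
    (hopt : M.IsFluidOptimal lam α χ)
    (A : ℕ)
    (harr : ∀ᶠ lam' in 𝓝[Set.Ici 0] lam, RealizesRates (M.arrival lam' α) A lam' α) :
    ∃ C : ℝ, ∀ᶠ η : ℝ in atTop,
      ∀ π : Policy n m, π = RandomMatching.policy M lam α χ (η ^ (-(1 / 3) : ℝ)) →
      π.IsImplementable M ∧
        (∃ ψ, π.IsSteadyState ψ) ∧
        (π.IsIrreducible → π.IsStable ∧ ∃! ψ, π.IsSteadyState ψ) ∧
        ∀ ψ, π.IsSteadyState ψ →
          (∀ i j, π.matchRate ψ i j = ENNReal.ofReal (χ i j)) ∧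
          π.InEquilibrium M ψ ∧
          π.meanQueue ψ ≠ ∞ ∧
          π.HasNetProfit M ψ ∧
          |π.netProfitLoss M η ψ| ≤ C * η ^ (1 / 3 : ℝ) := by
  have hlam : ∀ j, 0 ≤ lam j := fun j => by
    rw [hopt.1.customer_balance j]
    exact Finset.sum_nonneg fun i _ => hopt.1.nonneg i j
  choose D K δ hK hδ hr using fun j => M.exists_revenue_bound (hlam j) j
  have h2 : ∀ᶠ ε : ℝ in 𝓝[>] 0, ∀ j, n * ε < δ j := by
    refine eventually_all.2 fun j => ?_
    have : Tendsto (fun ε : ℝ => n * ε) (𝓝[>] 0) (𝓝 (n * 0)) :=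
      (tendsto_id.mono_left nhdsWithin_le_nhds).const_mul _
    rw [mul_zero] at this
    exact this.eventually_lt_const (hδ j)
  have hlim : Tendsto (fun η : ℝ => η ^ (-(1 / 3) : ℝ)) atTop (𝓝[>] 0) :=
    tendsto_nhdsWithin_iff.2 ⟨tendsto_rpow_neg_atTop (by norm_num),
      (eventually_gt_atTop 0).mono fun η hη => Real.rpow_pos_of_pos hη _⟩
  -- The first summand is the coefficient of ηε², from the revenue remainder; the second is that of
  -- 1/ε, from the waiting penalty. Both powers equal η^(1/3).
  refine ⟨(∑ j, K j) * n ^ 2 + (∑ i, M.s₁ i + ∑ j, M.s₂ j) * (n * m * A ^ 2 / 2), ?_⟩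
  filter_upwards [hlim.eventually ((eventually_admissible hopt.1 harr).and h2),
    eventually_gt_atTop 0] with η hη hη0
  obtain ⟨H, hδε⟩ := hη
  rintro π rfl
  refine ⟨H.isImplementable, ?_, fun hirr => ?_, fun ψ hψ => ?_⟩
  · obtain ⟨ψ, hψ⟩ := H.exists_stationary
    exact ⟨ψ, isSteadyState_iff.2 hψ⟩
  · obtain ⟨ψ, hψ⟩ := H.exists_stationary
    have hirr' := isIrreducible_iff.1 hirr
    exact ⟨isStable_iff.2 (MarkovChain.stable_of_stationary hirr' hψ), ψ,
      isSteadyState_iff.2 hψ, fun φ hφ =>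
        MarkovChain.IsStationary.unique hirr' (isSteadyState_iff.1 hφ) hψ⟩
  · have hψ' := isSteadyState_iff.1 hψ
    have hrates := H.rates_eq hψ'
    have hsum := (H.summable_slotProfit_and_abs_tsum_sub_le hψ' hK hδε hr).1
    refine ⟨H.matchRate_eq hψ', ⟨fun i j => ?_, fun q _ => ?_⟩, H.expect_total_ne_top hψ',
      ⟨fun q _ => ?_, hsum, H.summable_penalty hψ'⟩, ?_⟩
    · exact (H.matchRate_eq hψ' i j).trans_ne ENNReal.ofReal_ne_top
    -- Equilibrium is inherited from the fluid solution because the realized rates are exactly χ; no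
    -- continuity in χ is needed.
    · have h := hopt.1.support
      rw [← hrates] at h
      exact h
    · have h := hopt.1.integrable_cost
      rw [← hrates] at h
      exact h
    · refine (H.abs_netProfitLoss_le hψ' hK hδε hr hopt hη0.le).trans_eq ?_
      have hε1 : η * (η ^ (-(1 / 3) : ℝ)) ^ 2 = η ^ (1 / 3 : ℝ) := by
        rw [← Real.rpow_natCast, ← Real.rpow_mul hη0.le]
        nth_rewrite 1 [← Real.rpow_one η]
        rw [← Real.rpow_add hη0]
        norm_num
      have hε2 : 1 / η ^ (-(1 / 3) : ℝ) = η ^ (1 / 3 : ℝ) := by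
        rw [Real.rpow_neg hη0.le, one_div, inv_inv]
      rw [add_mul ((∑ j, K j) * (n : ℝ) ^ 2)]
      congr 1
      · rw [← hε1]; ring
      · rw [← hε2]; ring

end
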